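/- **Theorem 5.5.** Let $J=[n]\sqcup[n]^*$ with the involution $a\mapsto a^*$; a subset $A\subseteq J$ is *admissible* if $A\cap A^*=\emptyset$. For a matroid $\mathcal M$ on $J$ let $I^{ad}(\mathcal M)$ be the family of independent sets of $\mathcal M$ whose closure is admissible. A loopless matroid $\mathcal M$ on $J$ is called admissible if for every $A\subseteq J$ its rank $r(A)$ is the maximum, over all admissible independent sets $I\subseteq A$ of $\mathcal M$, of the number which is $|I|+2$ if there is $\{a,a^*\}\subseteq A$ with $I\cup\{a\},\,I\cup\{a^*\}\in I^{ad}(\mathcal M)$, and $|I|$ otherwise. Let $\mathcal S$ be a ranked symplectic matroid with enveloping matroid $\mathcal M$, that is, $\mathcal M$ is an admissible matroid on $J$ and $\mathcal S\neq\emptyset$ is the family of bases of $\mathcal M$ that are admissible sets. Let $L(\mathcal S)$ consist of $J$ and of all admissible flats of $\mathcal M$. For $A\subseteq J$ put $e^{\pm}_A=\sum_{i\in A\cap[n]}e_i-\sum_{i^*\in A\cap[n]^*}e_i\in\mathbb R^n$. Let $P(\mathcal S)$ be the convex hull of $\{e^{\pm}_B : B\in\mathcal S\}$. Its normal fan consists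 of the cones $\{\nu\in\mathbb R^n : \text{the functional } x\mapsto\sum_i x_i\nu_i \text{ attains its maximum over } P(\mathcal S) \text{ at every point of } Q\}$, where $Q$ runs through the nonempty faces of $P(\mathcal S)$. The Bergman fan $B(\mathcal S)$ is the collection of the cones $\bigl\{\sum_{F\in\mathcal F}a_F e^{\pm}_F : a_F\ge 0\bigr\}$, where $\mathcal F$ runs through the (possibly empty) chains $F_1\subsetneq\dots\subsetneq F_k$ in $L(\mathcal S)\setminus\{\emptyset,J\}$. Then $B(\mathcal S)$ is a refinement of a subfan of the normal fan of $P(\mathcal S)$. That is, $B(\mathcal S)$ is a polyhedral fan, and there is a polyhedral fan $\Sigma$, all of whose cones are cones of the normal fan of $P(\mathcal S)$, such that $B(\mathcal S)$ and $\Sigma$ have the same support and every cone of $B(\mathcal S)$ is contained in a cone of $\Sigma$. -/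

import Mathlib

/-- The ground set `J = [n] ⊔ [n]*`: `Sum.inl i` is the element `i`, `Sum.inr i` is `i*`, and the
involution `a ↦ a*` is `Sum.swap`. -/
abbrev SignedGround (n : ℕ) : Type := Fin n ⊕ Fin n

/-- `A ⊆ J` is admissible if `A ∩ A* = ∅`. -/
def AdmissibleSet {n : ℕ} (A : Set (SignedGround n)) : Prop :=
  ∀ a ∈ A, a.swap ∉ A

/-- The family `I^ad(M)` of independent sets of `M` with admissible closure. -/
def indepAd {n : ℕ} (M : Matroid (SignedGround n)) : Set (Set (SignedGround n)) :=
  {I | M.Indep I ∧ AdmissibleSet (M.closure I)}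

open Classical in
/-- The contribution of an admissible independent set `I ⊆ A` to the rank of `A`. -/
noncomputable def rankContribution {n : ℕ} (M : Matroid (SignedGround n))
    (A I : Set (SignedGround n)) : ℕ∞ :=
  if ∃ a ∈ A, a.swap ∈ A ∧ insert a I ∈ indepAd M ∧ insert a.swap I ∈ indepAd M then
    I.encard + 2
  else I.encard

/-- A loopless matroid on `J` is admissible if its rank function is derived from its family of
admissible independent sets: `r(A)` is the maximum of the contributions of the admissible
independent sets contained in `A`. -/
structure IsAdmissibleMatroid {n : ℕ} (M : Matroid (SignedGround n)) : Prop where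
  ground_eq : M.E = Set.univ
  loopless : M.Loopless
  rank_eq : ∀ A : Set (SignedGround n),
    IsGreatest {k : ℕ∞ | ∃ I ⊆ A, M.Indep I ∧ AdmissibleSet I ∧ k = rankContribution M A I}
      (M.eRk A)

/-- `S` (a family of bases) is a ranked symplectic matroid with enveloping matroid `M`:
`S` is the family of admissible bases of the admissible matroid `M`. As for every (symplectic)
matroid, the family of bases is nonempty. -/
structure IsRankedSymplectic {n : ℕ} (S : Set (Set (SignedGround n)))
    (M : Matroid (SignedGround n)) : Prop where
  admissible : IsAdmissibleMatroid M
  bases_eq : S = {B | M.IsBase B ∧ AdmissibleSet B}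
  nonempty : S.Nonempty

/-- The lattice of flats `L(S)`: the admissible flats of the enveloping matroid, and `J`. -/
def latticeOfFlats {n : ℕ} (M : Matroid (SignedGround n)) : Set (Set (SignedGround n)) :=
  {F | (M.IsFlat F ∧ AdmissibleSet F) ∨ F = Set.univ}

open Classical in
/-- The signed vector `e^±_A = ∑_{a ∈ A} sgn(a) e_a ∈ ℝⁿ`. -/
noncomputable def signedVec {n : ℕ} (A : Set (SignedGround n)) : Fin n → ℝ :=
  fun i => (if Sum.inl i ∈ A then 1 else 0) - (if Sum.inr i ∈ A then 1 else 0)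

/-- The matroid polytope `P(S)`: the convex hull of the points `e^±_B`, `B ∈ S`. -/
def matroidPolytope {n : ℕ} (S : Set (Set (SignedGround n))) : Set (Fin n → ℝ) :=
  convexHull ℝ (signedVec '' S)

/-- The face of `P` on which the linear functional `x ↦ ∑ xᵢ ωᵢ` attains its maximum. -/
def maxFace {n : ℕ} (P : Set (Fin n → ℝ)) (ω : Fin n → ℝ) : Set (Fin n → ℝ) :=
  {x | x ∈ P ∧ ∀ y ∈ P, y ⬝ᵥ ω ≤ x ⬝ᵥ ω}

/-- The (outer) normal cone of the face `maxFace P ω` of `P`: all functionals that attain their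
maximum over `P` at every point of that face. For a polytope it is the closure of the class of
functionals with the same maximal face as `ω`. -/
def normalCone {n : ℕ} (P : Set (Fin n → ℝ)) (ω : Fin n → ℝ) : PointedCone ℝ (Fin n → ℝ) where
  carrier := {ν | maxFace P ω ⊆ maxFace P ν}
  add_mem' := by
    intro a b ha hb x hx
    refine ⟨hx.1, fun y hy => ?_⟩
    rw [dotProduct_add, dotProduct_add]
    exact add_le_add ((ha hx).2 y hy) ((hb hx).2 y hy)
  zero_mem' := by
    intro x hx
    exact ⟨hx.1, fun y hy => by simp⟩
  smul_mem' := by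
    intro c a ha x hx
    refine ⟨hx.1, fun y hy => ?_⟩
    have h := mul_le_mul_of_nonneg_left ((ha hx).2 y hy) c.2
    have e : c • a = (c : ℝ) • a := rfl
    rw [e, dotProduct_smul, dotProduct_smul]
    exact h

/-- The normal fan of a polytope: the normal cones of its faces. -/
def normalFan {n : ℕ} (P : Set (Fin n → ℝ)) : Set (PointedCone ℝ (Fin n → ℝ)) :=
  Set.range (normalCone P)

/-- The Bergman fan `B(S)`: the order fan of the proper part of `L(S)`, whose cones are spanned
by the signed vectors `e^±_F` of the members of a (possibly empty) chain in `L(S) \ {∅, J}`. -/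
def bergmanFan {n : ℕ} (M : Matroid (SignedGround n)) : Set (PointedCone ℝ (Fin n → ℝ)) :=
  {σ | ∃ 𝓕 : Set (Set (SignedGround n)), 𝓕 ⊆ latticeOfFlats M \ {∅, Set.univ} ∧
    IsChain (· ⊆ ·) 𝓕 ∧ σ = PointedCone.hull ℝ (signedVec '' 𝓕)}

/-- A polyhedral fan: finitely many finitely generated cones, closed under taking faces, any two
of which meet in a common face. -/
structure IsFan {n : ℕ} (X : Set (PointedCone ℝ (Fin n → ℝ))) : Prop where
  finite : X.Finite
  fg : ∀ σ ∈ X, σ.FG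
  face_mem : ∀ σ ∈ X, ∀ τ : PointedCone ℝ (Fin n → ℝ), τ.IsFaceOf σ → τ ∈ X
  inter_face : ∀ σ ∈ X, ∀ τ ∈ X, (σ ⊓ τ).IsFaceOf σ ∧ (σ ⊓ τ).IsFaceOf τ

/-- The support of a collection of cones. -/
def fanSupport {n : ℕ} (X : Set (PointedCone ℝ (Fin n → ℝ))) : Set (Fin n → ℝ) :=
  ⋃ σ ∈ X, (σ : Set (Fin n → ℝ))

/-- `X` is a subfan of `Y`: a set of cones of `Y` that is itself a fan. -/
structure IsSubfan {n : ℕ} (X Y : Set (PointedCone ℝ (Fin n → ℝ))) : Prop where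
  subset : X ⊆ Y
  isFan : IsFan X

/-- The fan `X` refines the fan `Y`: they have the same support, and every cone of `X` lies in a
cone of `Y`. -/
structure FanRefines {n : ℕ} (X Y : Set (PointedCone ℝ (Fin n → ℝ))) : Prop where
  isFan_left : IsFan X
  isFan_right : IsFan Y
  support_eq : fanSupport X = fanSupport Y
  exists_le : ∀ σ ∈ X, ∃ τ ∈ Y, σ ≤ τ

/-! Extend `ω ∈ ℝⁿ` to an odd function on `J`. Its positive level sets form a chain of admissible
sets, and `ω` is a nonnegative combination of their signed vectors. It lies in the Bergman cone of a
chain `𝓕` exactly when its nonempty positive level sets belong to `𝓕`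
(`mem_hull_iff_levels_subset`). So the support of the Bergman fan is `flatVectors M`.

On the polytope side, the pairing of the signed vectors of `B` and `G` is `|B ∩ G| - |B ∩ G*|`. For
an admissible base `B` and an admissible set `G` this is at most `M.natRk G - M.defect G`. The key
fact is that a single admissible base attains this bound for all members of a chain at once
(`exists_isBase_of_isChain`). Hence a base maximizes `ω` iff it maximizes the signed vector of every
positive level set of `ω` (`mem_maximizers_iff`), so normal cones can be read off from level sets.

The fan `Σ` consists of the normal cones of flat vectors. Such a cone contains only flat vectors
(`flatVectors_of_maximizers_subset`), so `Σ` is closed under faces and has the right support. A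
Bergman cone lies in the normal cone of any of its points with a maximal family of level sets.

Admissibility of `M` enters mainly through one consequence of the rank formula: a flat that is not
admissible is closed under the involution. -/

section SignedSets

/-! ### Admissible sets and transversals of the involution. -/

variable {n : ℕ}

theorem AdmissibleSet.mono {A B : Set (SignedGround n)} (hB : AdmissibleSet B) (h : A ⊆ B) :
    AdmissibleSet A :=
  fun a ha ha' => hB a (h ha) (h ha')

theorem AdmissibleSet.insert {A : Set (SignedGround n)} {x : SignedGround n}
    (hA : AdmissibleSet A) (hx : x.swap ∉ A) : AdmissibleSet (insert x A) := by
  have hne : x.swap ≠ x := by cases x <;> simp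
  rintro a (rfl | ha) (h | h)
  · exact hne h
  · exact hx h
  · rw [← h, Sum.swap_swap] at hx
    exact hx ha
  · exact hA a ha h

theorem AdmissibleSet.union {A B : Set (SignedGround n)} (hA : AdmissibleSet A)
    (hB : AdmissibleSet B) (h : ∀ a ∈ A, a.swap ∉ B) : AdmissibleSet (A ∪ B) := by
  rintro a (ha | ha) (h' | h')
  · exact hA a ha h'
  · exact h a ha h'
  · exact h _ h' (by simpa using ha)
  · exact hB a ha h'

theorem AdmissibleSet.ncard_le {A : Set (SignedGround n)} (hA : AdmissibleSet A) :
    A.ncard ≤ n := by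
  have h := Set.ncard_le_ncard_of_injOn (t := (Set.univ : Set (Fin n)))
    (fun a : SignedGround n => Sum.elim id id a) (s := A) (fun _ _ => Set.mem_univ _) ?_
    (Set.toFinite _)
  · simpa [Set.ncard_univ] using h
  · rintro (i | i) hi (j | j) hj hij
    · simpa using hij
    · obtain rfl : i = j := hij
      exact absurd hj (hA _ hi)
    · obtain rfl : i = j := hij
      exact absurd hj (hA _ hi)
    · simpa using hij

theorem le_ncard_of_forall_mem_or_swap_mem {T : Set (SignedGround n)}
    (hT : ∀ a : SignedGround n, a ∈ T ∨ a.swap ∈ T) : n ≤ T.ncard := by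
  have h : (Set.univ : Set (Fin n)) ⊆ (fun a : SignedGround n => Sum.elim id id a) '' T := by
    intro i _
    rcases hT (Sum.inl i) with h | h
    · exact ⟨_, h, rfl⟩
    · exact ⟨_, h, rfl⟩
  have h1 := Set.ncard_le_ncard h (Set.toFinite _)
  have h2 := Set.ncard_image_le (f := fun a : SignedGround n => Sum.elim id id a) T.toFinite
  simpa [Set.ncard_univ] using h1.trans h2

theorem AdmissibleSet.exists_transversal {A : Set (SignedGround n)} (hA : AdmissibleSet A) :
    ∃ T, A ⊆ T ∧ AdmissibleSet T ∧ ∀ a : SignedGround n, a ∈ T ∨ a.swap ∈ T := by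
  refine ⟨A ∪ {a | a.isLeft ∧ a.swap ∉ A}, Set.subset_union_left, ?_, ?_⟩
  · refine hA.union ?_ ?_
    · rintro (i | i) ⟨h, -⟩ ⟨h', -⟩ <;> simp at h h'
    · rintro a ha ⟨-, h⟩
      simp [ha] at h
  · intro a
    by_cases ha : a ∈ A
    · exact Or.inl (Or.inl ha)
    by_cases ha' : a.swap ∈ A
    · exact Or.inr (Or.inl ha')
    rcases a with i | i
    · exact Or.inl (Or.inr ⟨rfl, ha'⟩)
    · exact Or.inr (Or.inr ⟨rfl, by simpa using ha⟩)

end SignedSets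

/-! ### Finite rank and bases adapted to a chain. -/

section Rank

variable {α : Type*}

/-- The rank of a set in a matroid on a finite type, as a natural number. -/
noncomputable def Matroid.natRk (M : Matroid α) (X : Set α) : ℕ := (M.eRk X).toNat

theorem Matroid.IsBasis.ncard_eq {M : Matroid α} {I X : Set α} (h : M.IsBasis I X) :
    I.ncard = M.natRk X := by
  rw [Matroid.natRk, ← h.encard_eq_eRk, Set.ncard]

theorem Matroid.natRk_closure (M : Matroid α) (X : Set α) :
    M.natRk (M.closure X) = M.natRk X := by
  rw [Matroid.natRk, Matroid.eRk_closure_eq, Matroid.natRk]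

theorem Matroid.IsBase.ncard_eq_natRk {M : Matroid α} (hE : M.E = Set.univ) {B : Set α}
    (h : M.IsBase B) : B.ncard = M.natRk Set.univ := by
  rw [← hE]
  exact h.isBasis_ground.ncard_eq

variable [_root_.Finite α]

theorem Matroid.coe_natRk (M : Matroid α) (X : Set α) : (M.natRk X : ℕ∞) = M.eRk X := by
  apply ENat.natCast_toNat
  exact ne_top_of_le_ne_top (Set.toFinite X).encard_lt_top.ne (M.eRk_le_encard X)

theorem Matroid.natRk_mono (M : Matroid α) {X Y : Set α} (h : X ⊆ Y) :
    M.natRk X ≤ M.natRk Y := by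
  have := M.eRk_mono h
  rw [← M.coe_natRk, ← M.coe_natRk] at this
  exact_mod_cast this

theorem Matroid.Indep.ncard_le_natRk {M : Matroid α} {I X : Set α} (h : M.Indep I)
    (hIX : I ⊆ X) : I.ncard ≤ M.natRk X := by
  have := h.encard_le_eRk_of_subset hIX
  rw [← M.coe_natRk, ← (Set.toFinite I).cast_ncard_eq] at this
  exact_mod_cast this

theorem Matroid.Indep.isBase_of_natRk_le {M : Matroid α} (hE : M.E = Set.univ) {I : Set α}
    (h : M.Indep I) (hI : M.natRk Set.univ ≤ I.ncard) : M.IsBase I := by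
  obtain ⟨B, hB, hIB⟩ := h.exists_isBase_superset
  rw [← hB.ncard_eq_natRk hE] at hI
  rwa [Set.eq_of_subset_of_ncard_le hIB hI (Set.toFinite _)]

theorem Matroid.natRk_union_le (M : Matroid α) (X Y : Set α) :
    M.natRk (X ∪ Y) ≤ M.natRk X + Y.ncard := by
  have h := M.eRk_union_le_eRk_add_encard X Y
  rw [← M.coe_natRk, ← M.coe_natRk, ← (Set.toFinite Y).cast_ncard_eq] at h
  exact_mod_cast h

theorem Matroid.natRk_add_ncard_le (M : Matroid α) {X Y : Set α} (h : X ⊆ Y) :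
    M.natRk Y + X.ncard ≤ M.natRk X + Y.ncard := by
  have h1 := M.natRk_union_le X (Y \ X)
  rw [Set.union_sdiff_cancel h] at h1
  have h2 := Set.ncard_sdiff_add_ncard_of_subset h (Set.toFinite _)
  omega

theorem Matroid.Indep.isBasis_of_natRk_le {M : Matroid α} (hE : M.E = Set.univ) {I X : Set α}
    (h : M.Indep I) (hIX : I ⊆ X) (hI : M.natRk X ≤ I.ncard) : M.IsBasis I X := by
  obtain ⟨B, hB, hIB⟩ := h.subset_isBasis_of_subset hIX (by simp [hE])
  rw [← hB.ncard_eq] at hI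
  rwa [Set.eq_of_subset_of_ncard_le hIB hI (Set.toFinite _)]

/-- In a matroid on a finite ground set, some independent set meets every member of a given chain
in a basis of that member. -/
theorem Matroid.exists_indep_isBasis_inter_of_isChain (M : Matroid α) (hE : M.E = Set.univ)
    (s : Finset (Set α)) (hs : IsChain (· ⊆ ·) (s : Set (Set α))) :
    ∃ I, M.Indep I ∧ ∀ G ∈ s, M.IsBasis (I ∩ G) G := by
  classical
  induction s using Finset.induction_on_max_value (fun G : Set α => G.ncard) with
  | empty => exact ⟨∅, M.empty_indep, by simp⟩
  | insert G s hG hmax ih =>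
    rw [Finset.coe_insert] at hs
    obtain ⟨I, hI, hb⟩ := ih (hs.mono (Set.subset_insert _ _))
    have hsub : ∀ G' ∈ s, G' ⊆ G := by
      intro G' hG'
      rcases hs.total (Set.mem_insert_of_mem _ (Finset.mem_coe.2 hG')) (Set.mem_insert _ _)
        with h | h
      · exact h
      · exact (Set.eq_of_subset_of_ncard_le h (hmax G' hG') (Set.toFinite _)).ge
    -- Only `I ∩ G` is extended, inside the new top member `G`. The intersections with smaller
    -- members can only grow, and they already have full rank.
    obtain ⟨I', hI', hII'⟩ := (hI.subset (Set.inter_subset_left (t := G))).subset_isBasis_of_subset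
      Set.inter_subset_right (by simp [hE])
    refine ⟨I', hI'.indep, ?_⟩
    intro G' hG'
    rcases Finset.mem_insert.1 hG' with rfl | h
    · rwa [Set.inter_eq_self_of_subset_left hI'.subset]
    · refine (hI'.indep.subset Set.inter_subset_left).isBasis_of_natRk_le hE
        Set.inter_subset_right ?_
      rw [← (hb G' h).ncard_eq]
      apply Set.ncard_le_ncard _ (Set.toFinite _)
      exact fun a ha => ⟨hII' ⟨ha.1, hsub _ h ha.2⟩, ha.2⟩

end Rank

/-! ### Flats and bases of admissible matroids. -/

section AdmissibleMatroid

variable {n : ℕ} {M : Matroid (SignedGround n)}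

/-- Apply the rank formula to `K` itself. An admissible `I ⊆ K` cannot be all of `K`, so the maximum
`|K|` is attained as `|I| + 2` and `K = I ∪ {a, a*}`. This is the only involution pair in `K`, so
deleting `b*` leaves `I ∪ {b}`, a member of `indepAd M`. -/
theorem IsAdmissibleMatroid.admissibleSet_closure_sdiff (hM : IsAdmissibleMatroid M)
    {K : Set (SignedGround n)} (hK : M.Indep K) {b : SignedGround n} (hb : b ∈ K)
    (hb' : b.swap ∈ K) : AdmissibleSet (M.closure (K \ {b.swap})) := by
  obtain ⟨I, hIK, hI, hIa, hc⟩ := (hM.rank_eq K).1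
  rw [hK.eRk_eq_encard, rankContribution] at hc
  have hIE : I ⊆ M.closure I := M.subset_closure I (by simp [hM.ground_eq])
  split_ifs at hc with h
  · obtain ⟨a, ha, ha', h1, h2⟩ := h
    have hcl : ∀ c, insert c I ∈ indepAd M → c.swap ∉ I ∧ c ≠ c.swap := by
      intro c hc
      have hs : insert c I ⊆ M.closure (insert c I) := M.subset_closure _ (by simp [hM.ground_eq])
      refine ⟨fun h => hc.2 c (hs (Set.mem_insert _ _)) (hs (Set.mem_insert_of_mem _ h)), ?_⟩
      cases c <;> simp
    obtain ⟨h3, h5⟩ := hcl a h1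
    obtain ⟨h4, -⟩ := hcl _ h2
    rw [Sum.swap_swap] at h4
    have hKe : insert a (insert a.swap I) = K := by
      refine Set.Finite.eq_of_subset_of_encard_le (Set.toFinite _) ?_ ?_
      · rintro x (rfl | rfl | hx)
        exacts [ha, ha', hIK hx]
      · rw [Set.encard_insert_of_notMem (by simp [h4, h5]), Set.encard_insert_of_notMem h3, hc,
          add_assoc, one_add_one_eq_two]
    have key : ∀ c, c ∈ K → c.swap ∈ K → c = a ∨ c = a.swap := by
      intro c hc hc'
      rw [← hKe] at hc hc'
      rcases hc with rfl | rfl | hc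
      · exact Or.inl rfl
      · exact Or.inr rfl
      · rcases hc' with h | h | h
        · exact Or.inr (by rw [← h, Sum.swap_swap])
        · exact Or.inl (by simpa using congrArg Sum.swap h)
        · exact absurd h (hIa c hc)
    rcases key b hb hb' with rfl | rfl
    · refine h1.2.mono (M.closure_subset_closure ?_)
      rw [← hKe]
      rintro x ⟨rfl | rfl | hx, hx'⟩
      · exact Set.mem_insert _ _
      · exact absurd rfl hx'
      · exact Set.mem_insert_of_mem _ hx
    · refine h2.2.mono (M.closure_subset_closure ?_)
      rw [← hKe, Sum.swap_swap]
      rintro x ⟨rfl | rfl | hx, hx'⟩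
      · exact absurd rfl hx'
      · exact Set.mem_insert _ _
      · exact Set.mem_insert_of_mem _ hx
  · have : I = K := Set.Finite.eq_of_subset_of_encard_le (Set.toFinite _) hIK hc.le
    subst this
    exact absurd hb' (hIa b hb)

/-- A flat of an admissible matroid that is not admissible is closed under the involution. -/
theorem IsAdmissibleMatroid.swap_mem_of_isFlat (hM : IsAdmissibleMatroid M)
    {F : Set (SignedGround n)} (hF : M.IsFlat F) (hFa : ¬ AdmissibleSet F) {b : SignedGround n}
    (hb : b ∈ F) : b.swap ∈ F := by
  by_contra hb'
  have := hM.loopless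
  have hbi : M.Indep {b} := by
    rw [Matroid.indep_singleton]
    exact Matroid.isNonloop_of_loopless (by simp [hM.ground_eq])
  obtain ⟨K, hK, hbK⟩ := hbi.subset_isBasis_of_subset (Set.singleton_subset_iff.2 hb)
  have hcl : M.closure K = F := by rw [hK.closure_eq_closure, hF.closure]
  have hbK' : b.swap ∉ K := fun h => hb' (hK.subset h)
  have hi : M.Indep (insert b.swap K) := by
    rw [hK.indep.insert_indep_iff_of_notMem hbK', hcl, hM.ground_eq]
    exact ⟨Set.mem_univ _, hb'⟩
  have := hM.admissibleSet_closure_sdiff hi (Set.mem_insert_of_mem _ (hbK rfl))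
    (Set.mem_insert _ _)
  rw [Set.insert_sdiff_of_mem _ (Set.mem_singleton _), Set.sdiff_singleton_eq_self hbK', hcl] at this
  exact hFa this

/-- Take `B` maximal among admissible independent sets that contain `I` and avoid `U*`. If its
closure is admissible, maximality makes `U ∪ B` meet every pair `{a, a*}`, and counting with `hr`
gives `|B|` full rank. Otherwise the closure is closed under the involution, and any point outside
it could still be added. -/
theorem IsAdmissibleMatroid.exists_isBase_disjoint (hM : IsAdmissibleMatroid M)
    {U I : Set (SignedGround n)} (hU : AdmissibleSet U) (hI : M.IsBasis I U)
    (hr : M.natRk Set.univ + U.ncard ≤ M.natRk U + n) :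
    ∃ B, M.IsBase B ∧ AdmissibleSet B ∧ I ⊆ B ∧ ∀ u ∈ U, u.swap ∉ B := by
  obtain ⟨B, hB⟩ := Set.Finite.exists_maximal
    (s := {B | M.Indep B ∧ AdmissibleSet B ∧ I ⊆ B ∧ ∀ u ∈ U, u.swap ∉ B}) (Set.toFinite _)
    ⟨I, hI.indep, hU.mono hI.subset, Set.Subset.rfl, fun u hu h => hU u hu (hI.subset h)⟩
  obtain ⟨hBi, hBa, hIB, hUB⟩ := hB.prop
  refine ⟨B, ?_, hBa, hIB, hUB⟩
  have hmax : ∀ x, x ∉ M.closure B → x.swap ∉ B → x.swap ∉ U → False := by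
    intro x hx hxB hxU
    have hxB' : x ∉ B := fun h => hx (M.mem_closure_of_mem h (by simp [hM.ground_eq]))
    apply hxB'
    apply hB.le_of_ge (y := insert x B) _ (Set.subset_insert _ _) (Set.mem_insert _ _)
    refine ⟨?_, hBa.insert hxB, hIB.trans (Set.subset_insert _ _), ?_⟩
    · rw [hBi.insert_indep_iff_of_notMem hxB', hM.ground_eq]
      exact ⟨Set.mem_univ _, hx⟩
    · rintro u hu (h | h)
      · apply hxU
        rwa [← h, Sum.swap_swap]
      · exact hUB u hu h
  by_cases ha : AdmissibleSet (M.closure B)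
  · refine hBi.isBase_of_natRk_le hM.ground_eq ?_
    have h1 : n ≤ (U ∪ B).ncard := by
      refine le_ncard_of_forall_mem_or_swap_mem fun a => ?_
      by_contra! h
      simp only [Set.mem_union, not_or] at h
      obtain ⟨⟨h1, h2⟩, h3, h4⟩ := h
      by_cases hc : a ∈ M.closure B
      · exact hmax a.swap (ha a hc) (by simpa using h2) (by simpa using h1)
      · exact hmax a hc h4 h3
    have h2 : (U ∪ B).ncard + (U ∩ B).ncard = U.ncard + B.ncard :=
      Set.ncard_union_add_ncard_inter U B
    have h3 : I.ncard ≤ (U ∩ B).ncard :=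
      Set.ncard_le_ncard (Set.subset_inter hI.subset hIB) (Set.toFinite _)
    rw [hI.ncard_eq] at h3
    omega
  · refine hBi.isBase_of_ground_subset_closure ?_
    intro x _
    by_contra hx
    have hsw : ∀ a ∈ M.closure B, a.swap ∈ M.closure B := fun a h =>
      hM.swap_mem_of_isFlat (M.isFlat_closure B) ha h
    have hx' : x.swap ∉ M.closure B := fun h => hx (by simpa using hsw _ h)
    refine hmax x hx (fun h => hx' (M.mem_closure_of_mem h (by simp [hM.ground_eq]))) fun h => ?_
    exact hx' (M.closure_subset_closure hIB (hI.subset_closure h))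

theorem IsAdmissibleMatroid.exists_isBase_superset (hM : IsAdmissibleMatroid M)
    (hr : M.natRk Set.univ ≤ n) {I : Set (SignedGround n)} (hI : M.Indep I)
    (hIa : AdmissibleSet I) : ∃ B, M.IsBase B ∧ AdmissibleSet B ∧ I ⊆ B := by
  -- For `U = I` independent, rank and size cancel and the counting hypothesis becomes `hr`.
  obtain ⟨B, h1, h2, h3, -⟩ := hM.exists_isBase_disjoint hIa hI.isBasis_self (by
    rw [← hI.isBasis_self.ncard_eq]
    omega)
  exact ⟨B, h1, h2, h3⟩

/-- Adding one point outside the closure of `T` creates an involution pair. The new closure is then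
closed under the involution and contains `T`, so it is everything. -/
theorem IsAdmissibleMatroid.natRk_univ_le_of_transversal (hM : IsAdmissibleMatroid M)
    {T : Set (SignedGround n)} (hT : ∀ a : SignedGround n, a ∈ T ∨ a.swap ∈ T) :
    M.natRk Set.univ ≤ M.natRk T + 1 := by
  by_cases h : M.closure T = Set.univ
  · rw [← h, M.natRk_closure]
    exact Nat.le_succ _
  · obtain ⟨x, hx⟩ := (Set.ne_univ_iff_exists_notMem _).1 h
    have hTE : ∀ X : Set (SignedGround n), X ⊆ M.closure X := fun X =>
      M.subset_closure _ (by simp [hM.ground_eq])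
    have hxT : x.swap ∈ T := (hT x).resolve_left fun h => hx (hTE _ h)
    have hna : ¬ AdmissibleSet (M.closure (T ∪ {x})) := fun h =>
      h x (hTE _ (Or.inr rfl)) (hTE _ (Or.inl hxT))
    have hu : M.closure (T ∪ {x}) = Set.univ := by
      refine Set.eq_univ_of_forall fun a => ?_
      rcases hT a with h | h
      · exact hTE _ (Or.inl h)
      · simpa using hM.swap_mem_of_isFlat (M.isFlat_closure _) hna (hTE _ (Or.inl h))
    rw [← hu, M.natRk_closure]
    simpa using M.natRk_union_le T {x}

/-- Nullity grows with the set, so it suffices to bound it on a transversal. Consequently an excess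
of nullity, as measured by `Matroid.defect`, is never more than one. -/
theorem IsAdmissibleMatroid.natRk_add_ncard_le (hM : IsAdmissibleMatroid M)
    {U : Set (SignedGround n)} (hU : AdmissibleSet U) :
    M.natRk Set.univ + U.ncard ≤ M.natRk U + n + 1 := by
  obtain ⟨T, hUT, hTa, hT⟩ := hU.exists_transversal
  have h1 := hM.natRk_univ_le_of_transversal hT
  have h2 := M.natRk_add_ncard_le hUT
  have h3 := hTa.ncard_le
  omega

/-- The bound improves by one because of a point `x` in the closure but not in `U`. If `x* ∈ U`, any
transversal containing `U` already spans; otherwise `U ∪ {x}` is admissible, larger, and of the same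
rank. So only flats can have defect one. -/
theorem IsAdmissibleMatroid.natRk_add_ncard_le_of_not_isFlat (hM : IsAdmissibleMatroid M)
    {U : Set (SignedGround n)} (hU : AdmissibleSet U) (hf : ¬ M.IsFlat U) :
    M.natRk Set.univ + U.ncard ≤ M.natRk U + n := by
  have hsub : ∀ X : Set (SignedGround n), X ⊆ M.closure X := fun X =>
    M.subset_closure _ (by simp [hM.ground_eq])
  obtain ⟨x, hx, hxU⟩ : ∃ x ∈ M.closure U, x ∉ U := by
    by_contra! h
    exact hf ((hsub U).antisymm h ▸ M.isFlat_closure U)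
  by_cases hxs : x.swap ∈ U
  · obtain ⟨T, hUT, hTa, hT⟩ := hU.exists_transversal
    have hna : ¬ AdmissibleSet (M.closure T) := fun h =>
      h x (M.closure_subset_closure hUT hx) (hsub _ (hUT hxs))
    have hu : M.closure T = Set.univ := by
      refine Set.eq_univ_of_forall fun a => ?_
      rcases hT a with h | h
      · exact hsub _ h
      · simpa using hM.swap_mem_of_isFlat (M.isFlat_closure _) hna (hsub _ h)
    rw [← hu, M.natRk_closure]
    have h2 := M.natRk_add_ncard_le hUT
    have h3 := hTa.ncard_le
    omega
  · have h1 := hM.natRk_add_ncard_le (hU.insert hxs)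
    rw [Set.ncard_insert_of_notMem hxU (Set.toFinite _)] at h1
    have h2 : M.natRk (insert x U) ≤ M.natRk U := by
      rw [← M.natRk_closure U]
      exact M.natRk_mono (Set.insert_subset hx (hsub U))
    omega

/-- Otherwise `U ∪ B` would be admissible with more than `n` elements, since `|U ∩ B|` is at most
the rank of `U`. -/
theorem exists_swap_mem_of_lt {U B : Set (SignedGround n)} (hE : M.E = Set.univ)
    (hU : AdmissibleSet U) (hB : M.IsBase B) (hBa : AdmissibleSet B)
    (hr : M.natRk U + n < M.natRk Set.univ + U.ncard) : ∃ u ∈ U, u.swap ∈ B := by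
  by_contra! h
  have h1 := (hU.union hBa h).ncard_le
  have h2 := Set.ncard_union_add_ncard_inter U B
  have h3 := (hB.indep.subset (Set.inter_subset_right (s := U))).ncard_le_natRk
    Set.inter_subset_left
  rw [← hB.ncard_eq_natRk hE] at hr
  omega

open Classical in
/-- The number of elements of the reflection of an admissible set that every admissible base has
to contain. -/
noncomputable def Matroid.defect (M : Matroid (SignedGround n)) (U : Set (SignedGround n)) : ℕ :=
  if M.natRk U + n < M.natRk Set.univ + U.ncard then 1 else 0

theorem defect_le_ncard {U B : Set (SignedGround n)} (hE : M.E = Set.univ)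
    (hU : AdmissibleSet U) (hB : M.IsBase B) (hBa : AdmissibleSet B) :
    M.defect U ≤ (B ∩ Sum.swap ⁻¹' U).ncard := by
  unfold Matroid.defect
  split_ifs with h
  · obtain ⟨u, hu, hu'⟩ := exists_swap_mem_of_lt hE hU hB hBa h
    rw [Nat.one_le_iff_ne_zero, ← Nat.pos_iff_ne_zero, Set.ncard_pos (Set.toFinite _)]
    exact ⟨u.swap, hu', by simpa using hu⟩
  · exact Nat.zero_le _

/-- Start from `I ⊆ U` containing a basis of each member. If `U` has defect zero, extend `I` while
avoiding `U*`. If it has defect one, exactly one element `y*` of `U*` is forced; it is chosen so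
that `y` lies in precisely the members of defect one. -/
theorem IsAdmissibleMatroid.exists_isBase_of_isChain_of_mem (hM : IsAdmissibleMatroid M)
    (hr : M.natRk Set.univ ≤ n) {𝓖 : Set (Set (SignedGround n))} (h𝓖 : IsChain (· ⊆ ·) 𝓖)
    {U : Set (SignedGround n)} (hU : AdmissibleSet U) (hU𝓖 : U ∈ 𝓖) (hsub : ∀ G ∈ 𝓖, G ⊆ U) :
    ∃ B, M.IsBase B ∧ AdmissibleSet B ∧ ∀ G ∈ 𝓖, (B ∩ G).ncard = M.natRk G ∧
      (B ∩ Sum.swap ⁻¹' G).ncard = M.defect G := by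
  have hE := hM.ground_eq
  have hf := Set.toFinite 𝓖
  obtain ⟨I₀, hI₀, hb₀⟩ := M.exists_indep_isBasis_inter_of_isChain hE hf.toFinset (by simpa using h𝓖)
  obtain ⟨I, hI, hb, hIU⟩ : ∃ I, M.Indep I ∧ (∀ G ∈ 𝓖, M.IsBasis (I ∩ G) G) ∧ I ⊆ U := by
    refine ⟨I₀ ∩ U, hI₀.subset Set.inter_subset_left, fun G hG => ?_, Set.inter_subset_right⟩
    rw [Set.inter_assoc, Set.inter_eq_self_of_subset_right (hsub G hG)]
    exact hb₀ G (by simpa using hG)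
  have hIb : M.IsBasis I U := by
    simpa [Set.inter_eq_self_of_subset_left hIU] using hb U hU𝓖
  have hnull : ∀ G ∈ 𝓖, M.natRk G + (G \ I).ncard = G.ncard := by
    intro G hG
    rw [← (hb G hG).ncard_eq, Set.inter_comm]
    exact Set.ncard_inter_add_ncard_sdiff_eq_ncard G I
  have hBG : ∀ B, M.IsBase B → I ⊆ B → ∀ G ∈ 𝓖, (B ∩ G).ncard = M.natRk G := by
    intro B hB hIB G hG
    refine le_antisymm ((hB.indep.subset Set.inter_subset_left).ncard_le_natRk
      Set.inter_subset_right) ?_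
    rw [← (hb G hG).ncard_eq]
    exact Set.ncard_le_ncard (Set.inter_subset_inter_left _ hIB) (Set.toFinite _)
  have hUn := hnull U hU𝓖
  by_cases hd : M.natRk U + n < M.natRk Set.univ + U.ncard
  · have hflat : M.IsFlat U := by
      by_contra h
      have := hM.natRk_add_ncard_le_of_not_isFlat hU h
      omega
    have hle := hM.natRk_add_ncard_le hU
    -- `G₀` is the largest member of defect zero, or `∅` if there is none. As `|G \ I|` is the
    -- nullity of `G`, `U` has more points off `I` than `G₀`, which leaves room for `y`.
    obtain ⟨y, hyU, hyI, hy⟩ : ∃ y ∈ U, y ∉ I ∧ ∀ G ∈ 𝓖, y ∈ G →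
        M.natRk G + n < M.natRk Set.univ + G.ncard := by
      obtain ⟨G₀, hG₀, hmax⟩ := Set.exists_max_image
        (insert ∅ {G ∈ 𝓖 | M.natRk Set.univ + G.ncard ≤ M.natRk G + n})
        (fun G : Set (SignedGround n) => G.ncard) (Set.toFinite _) ⟨∅, Set.mem_insert _ _⟩
      have hlt : (G₀ \ I).ncard < (U \ I).ncard := by
        rcases hG₀ with rfl | ⟨h1, h2⟩
        · simp only [Set.empty_sdiff, Set.ncard_empty]
          omega
        · have := hnull G₀ h1
          omega
      obtain ⟨y, ⟨hyU, hyI⟩, hy⟩ := Set.exists_mem_notMem_of_ncard_lt_ncard hlt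
      refine ⟨y, hyU, hyI, fun G hG hyG => ?_⟩
      by_contra! hle
      have h1 := hmax G (Or.inr ⟨hG, hle⟩)
      have h2 : G ⊆ G₀ := by
        rcases hG₀ with rfl | ⟨h3, -⟩
        · simp only [Set.ncard_empty, Nat.le_zero, Set.ncard_eq_zero (Set.toFinite G)] at h1
          rw [h1]
        · rcases h𝓖.total hG h3 with h | h
          · exact h
          · exact (Set.eq_of_subset_of_ncard_le h h1 (Set.toFinite _)).ge
      exact hy ⟨h2 hyG, hyI⟩
    have hyU' : y.swap ∉ U := hU y hyU
    have hyI' : y.swap ∉ I := fun h => hyU' (hIU h)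
    have hcl : M.closure I = U := by rw [hIb.closure_eq_closure, hflat.closure]
    have hi : M.Indep (insert y.swap I) := by
      rw [hI.insert_indep_iff_of_notMem hyI', hcl, hE]
      exact ⟨Set.mem_univ _, hyU'⟩
    obtain ⟨B, hB, hBa, hIB⟩ := hM.exists_isBase_superset hr hi
      ((hU.mono hIU).insert (by simpa using hyI))
    have hIB' : I ⊆ B := (Set.subset_insert _ _).trans hIB
    refine ⟨B, hB, hBa, fun G hG => ⟨hBG B hB hIB' G hG, ?_⟩⟩
    have hna : ¬ AdmissibleSet (M.closure (insert y.swap I)) := by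
      intro h
      refine h y ?_ (M.mem_closure_of_mem (Set.mem_insert _ _) (by simp [hE]))
      exact M.closure_subset_closure (Set.subset_insert _ _) (hcl.ge hyU)
    -- The closure of `I ∪ {y*}` contains `y` and `y*`, hence all of `U*`; no further element of
    -- `U*` can be independent of it.
    have hone : B ∩ Sum.swap ⁻¹' U = {y.swap} := by
      ext z
      constructor
      · rintro ⟨hzB, hzU⟩
        have hzI : z ∉ I := fun h => hU z (hIU h) hzU
        by_contra hne
        have hz : z ∈ M.closure (insert y.swap I) := by
          have : z.swap ∈ M.closure (insert y.swap I) :=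
            M.closure_subset_closure (Set.subset_insert _ _) (hcl.ge hzU)
          simpa using hM.swap_mem_of_isFlat (M.isFlat_closure _) hna this
        have hzi : M.Indep (insert z (insert y.swap I)) :=
          hB.indep.subset (Set.insert_subset hzB hIB)
        have hzn : z ∉ insert y.swap I := by
          rintro (h | h)
          exacts [hne h, hzI h]
        exact ((hi.insert_indep_iff_of_notMem hzn).1 hzi).2 hz
      · rintro rfl
        exact ⟨hIB (Set.mem_insert _ _), by simpa using hyU⟩
    unfold Matroid.defect
    have hGU : B ∩ Sum.swap ⁻¹' G ⊆ {y.swap} := by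
      rw [← hone]
      exact Set.inter_subset_inter_right _ (Set.preimage_mono (hsub G hG))
    have hBy : y.swap ∈ B := hIB (Set.mem_insert _ _)
    split_ifs with hdG
    · have hyG : y ∈ G := by
        have h1 := hnull G hG
        -- Defect one forces nullity at least `n - r + 1`, with `r` the rank of `M`. This is also
        -- the upper bound for `U`, so the two differences coincide.
        have h2 : G \ I = U \ I := Set.eq_of_subset_of_ncard_le
          (Set.sdiff_subset_sdiff_left (hsub G hG)) (by omega) (Set.toFinite _)
        have h3 : y ∈ G \ I := h2 ▸ ⟨hyU, hyI⟩
        exact h3.1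
      rw [Set.ncard_eq_one]
      refine ⟨y.swap, hGU.antisymm ?_⟩
      rintro _ rfl
      exact ⟨hBy, by simpa using hyG⟩
    · rw [Set.ncard_eq_zero (Set.toFinite _), Set.eq_empty_iff_forall_notMem]
      intro z hz
      obtain rfl : z = y.swap := hGU hz
      exact hdG (hy G hG (by simpa using hz.2))
  · obtain ⟨B, hB, hBa, hIB, hBU⟩ := hM.exists_isBase_disjoint hU hIb (by omega)
    refine ⟨B, hB, hBa, fun G hG => ⟨hBG B hB hIB G hG, ?_⟩⟩
    have h1 := M.natRk_add_ncard_le (hsub G hG)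
    rw [Matroid.defect, if_neg (by omega), Set.ncard_eq_zero (Set.toFinite _),
      Set.eq_empty_iff_forall_notMem]
    rintro z ⟨hz, hzG⟩
    exact hBU _ (hsub G hG hzG) (by simpa using hz)

/-- For a chain of admissible sets there is an admissible base that meets every member of the
chain in as many, and its reflection in as few, elements as possible. -/
theorem IsAdmissibleMatroid.exists_isBase_of_isChain (hM : IsAdmissibleMatroid M)
    (hr : M.natRk Set.univ ≤ n) {𝓖 : Set (Set (SignedGround n))} (h𝓖 : IsChain (· ⊆ ·) 𝓖)
    (ha : ∀ G ∈ 𝓖, AdmissibleSet G) :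
    ∃ B, M.IsBase B ∧ AdmissibleSet B ∧ ∀ G ∈ 𝓖, (B ∩ G).ncard = M.natRk G ∧
      (B ∩ Sum.swap ⁻¹' G).ncard = M.defect G := by
  have hU : AdmissibleSet (⋃₀ 𝓖) := by
    rintro a ⟨G, hG, haG⟩ ⟨G', hG', haG'⟩
    rcases h𝓖.total hG hG' with h | h
    · exact ha G' hG' a (h haG) haG'
    · exact ha G hG a haG (h haG')
  -- Adjoining the union supplies the top member, even for an empty chain.
  obtain ⟨B, h1, h2, h3⟩ := hM.exists_isBase_of_isChain_of_mem hr (𝓖 := insert (⋃₀ 𝓖) 𝓖)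
    (h𝓖.insert fun G hG _ => Or.inr (Set.subset_sUnion_of_mem hG)) hU (Set.mem_insert _ _) (by
      rintro G (rfl | hG)
      exacts [Set.Subset.rfl, Set.subset_sUnion_of_mem hG])
  exact ⟨B, h1, h2, fun G hG => h3 G (Or.inr hG)⟩

end AdmissibleMatroid

/-! ### Level sets of vectors and cones of chains. -/

section Levels

variable {n : ℕ}

/-- The extension of a vector to an odd function on the signed ground set. -/
def signedVal (ω : Fin n → ℝ) (a : SignedGround n) : ℝ :=
  Sum.elim ω (fun i => -ω i) a

theorem signedVal_swap (ω : Fin n → ℝ) (a : SignedGround n) :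
    signedVal ω a.swap = -signedVal ω a := by
  cases a <;> simp [signedVal]

theorem signedVal_add (ω ν : Fin n → ℝ) (a : SignedGround n) :
    signedVal (ω + ν) a = signedVal ω a + signedVal ν a := by
  cases a <;> simp [signedVal, add_comm]

theorem signedVal_smul (c : ℝ) (ω : Fin n → ℝ) (a : SignedGround n) :
    signedVal (c • ω) a = c * signedVal ω a := by
  cases a <;> simp [signedVal]

theorem signedVal_sub (ω ν : Fin n → ℝ) (a : SignedGround n) :
    signedVal (ω - ν) a = signedVal ω a - signedVal ν a := by
  cases a
  · simp [signedVal]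
  · simp [signedVal, neg_add_eq_sub]

open Classical in
theorem signedVal_signedVec (A : Set (SignedGround n)) (a : SignedGround n) :
    signedVal (signedVec A) a = (if a ∈ A then 1 else 0) - (if a.swap ∈ A then 1 else 0) := by
  cases a
  · simp only [signedVal, signedVec, Sum.elim_inl, Sum.swap_inl]
    congr
  · simp only [signedVal, signedVec, Sum.elim_inr, Sum.swap_inr, neg_sub]
    congr

/-- The elements on which a vector has value at least `t`. -/
def level (ω : Fin n → ℝ) (t : ℝ) : Set (SignedGround n) := {a | t ≤ signedVal ω a}

theorem mem_level {ω : Fin n → ℝ} {t : ℝ} {a : SignedGround n} :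
    a ∈ level ω t ↔ t ≤ signedVal ω a := Iff.rfl

/-- The positive level sets of a vector. -/
def levels (ω : Fin n → ℝ) : Set (Set (SignedGround n)) := {G | ∃ t, 0 < t ∧ G = level ω t}

theorem level_mem_levels (ω : Fin n → ℝ) {t : ℝ} (ht : 0 < t) : level ω t ∈ levels ω :=
  ⟨t, ht, rfl⟩

theorem admissibleSet_of_mem_levels {ω : Fin n → ℝ} {G : Set (SignedGround n)}
    (hG : G ∈ levels ω) : AdmissibleSet G := by
  obtain ⟨t, ht, rfl⟩ := hG
  intro a ha ha'
  rw [mem_level, signedVal_swap] at ha'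
  rw [mem_level] at ha
  linarith

theorem level_anti (ω : Fin n → ℝ) {s t : ℝ} (h : s ≤ t) : level ω t ⊆ level ω s :=
  fun _ ha => le_trans h ha

theorem isChain_levels (ω : Fin n → ℝ) : IsChain (· ⊆ ·) (levels ω) := by
  rintro _ ⟨s, -, rfl⟩ _ ⟨t, -, rfl⟩ -
  rcases le_total s t with h | h
  · exact Or.inr (level_anti ω h)
  · exact Or.inl (level_anti ω h)

theorem empty_mem_levels (ω : Fin n → ℝ) : ∅ ∈ levels ω := by
  obtain ⟨c, hc⟩ := (Set.finite_range (signedVal ω)).bddAbove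
  refine ⟨max c 0 + 1, by positivity, ?_⟩
  ext a
  have h1 := hc ⟨a, rfl⟩
  have h2 := le_max_left c 0
  simp only [Set.mem_empty_iff_false, mem_level, false_iff, not_le]
  linarith

theorem level_zero {t : ℝ} (ht : 0 < t) : level (0 : Fin n → ℝ) t = ∅ := by
  ext a
  cases a <;> simp [mem_level, signedVal, ht]

theorem levels_smul_subset (c : NNReal) (ω : Fin n → ℝ) : levels (c • ω) ⊆ levels ω := by
  rintro _ ⟨t, ht, rfl⟩
  rcases eq_or_ne c 0 with rfl | hc
  · rw [zero_smul, level_zero ht]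
    exact empty_mem_levels ω
  · have hc' : (0 : ℝ) < c := by positivity
    refine ⟨t / c, by positivity, ?_⟩
    ext a
    rw [mem_level, mem_level, NNReal.smul_def, signedVal_smul, div_le_iff₀' hc']

theorem level_signedVec {G : Set (SignedGround n)} (hG : AdmissibleSet G) {t : ℝ} (h0 : 0 < t)
    (h1 : t ≤ 1) : level (signedVec G) t = G := by
  ext a
  rw [mem_level, signedVal_signedVec]
  by_cases ha : a ∈ G
  · simp [ha, hG a ha, h1]
  · simp only [ha, if_false, iff_false, not_le]
    split_ifs <;> linarith

theorem levels_signedVec_subset {G : Set (SignedGround n)} (hG : AdmissibleSet G) :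
    levels (signedVec G) ⊆ {∅, G} := by
  rintro _ ⟨t, ht, rfl⟩
  rcases le_or_gt t 1 with h | h
  · exact Or.inr (level_signedVec hG ht h)
  · left
    ext a
    simp only [mem_level, signedVal_signedVec, Set.mem_empty_iff_false, iff_false, not_le]
    split_ifs <;> linarith

theorem setOf_lt_signedVal_mem_levels (ω : Fin n → ℝ) {c : ℝ} (hc : 0 ≤ c) :
    {a | c < signedVal ω a} ∈ levels ω := by
  rcases Set.eq_empty_or_nonempty {a | c < signedVal ω a} with h | h
  · rw [h]
    exact empty_mem_levels ω
  · obtain ⟨a, ha, hmin⟩ := Set.exists_min_image _ (signedVal ω) (Set.toFinite _) h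
    refine ⟨signedVal ω a, hc.trans_lt ha, ?_⟩
    ext b
    refine ⟨fun hb => hmin b hb, fun hb => ?_⟩
    rw [Set.mem_ofPred_eq] at ha ⊢
    exact ha.trans_le hb

/-- Subtracting a suitable multiple of the vector of a level set removes this level set. -/
theorem exists_levels_sub_subset {ω : Fin n → ℝ} {G : Set (SignedGround n)} (hG : G ∈ levels ω)
    (hne : G.Nonempty) : ∃ ε : ℝ, 0 < ε ∧ levels (ω - ε • signedVec G) ⊆ levels ω \ {G} := by
  classical
  have hGa := admissibleSet_of_mem_levels hG
  obtain ⟨a₀, ha₀, hmin⟩ := Set.exists_min_image G (signedVal ω) (Set.toFinite _) hne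
  obtain ⟨b₀, hb₀, hmax⟩ := Set.exists_max_image Gᶜ (signedVal ω) (Set.toFinite _)
    ⟨_, hGa a₀ ha₀⟩
  obtain ⟨s, hs, hGs⟩ := hG
  have hmem : ∀ a, a ∈ G ↔ s ≤ signedVal ω a := fun a => by rw [hGs, mem_level]
  -- The smallest value on `G` is `t`, and `u` is the next value below it, cut off at `0`. Lowering
  -- `G` by `t - u` merges these two steps: levels up to `u` are unchanged, and those above are
  -- shifted.
  set t := signedVal ω a₀ with ht
  set u := max (signedVal ω b₀) 0 with hu
  have hst : s ≤ t := (hmem a₀).1 ha₀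
  have hut : u < t := by
    have : signedVal ω b₀ < s := not_le.1 fun h => hb₀ ((hmem b₀).2 h)
    exact max_lt (by linarith) (by linarith)
  have hu0 : 0 ≤ u := le_max_right _ _
  have hub : ∀ b, b ∉ G → signedVal ω b ≤ u := fun b hb => (hmax b hb).trans (le_max_left _ _)
  have hval : ∀ a, signedVal (ω - (t - u) • signedVec G) a =
      signedVal ω a - (t - u) * ((if a ∈ G then 1 else 0) - (if a.swap ∈ G then 1 else 0)) := by
    intro a
    rw [signedVal_sub, signedVal_smul, signedVal_signedVec]
  have hin : ∀ a ∈ G, signedVal (ω - (t - u) • signedVec G) a = signedVal ω a - (t - u) := by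
    intro a ha
    simp [hval, ha, hGa a ha]
  have hneg : ∀ a, a.swap ∈ G → signedVal ω a ≤ -t ∧
      signedVal (ω - (t - u) • signedVec G) a = signedVal ω a + (t - u) := by
    intro a ha
    have h1 := hmin _ ha
    rw [signedVal_swap] at h1
    have h2 : a ∉ G := fun h => hGa a h ha
    refine ⟨by linarith, ?_⟩
    rw [hval, if_pos ha, if_neg h2]
    ring
  have hout : ∀ a, a ∉ G → a.swap ∉ G →
      signedVal (ω - (t - u) • signedVec G) a = signedVal ω a := by
    intro a h1 h2
    simp [hval, h1, h2]
  refine ⟨t - u, by linarith, ?_⟩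
  rintro _ ⟨r, hr, rfl⟩
  rcases le_or_gt r u with hru | hru
  · have : level (ω - (t - u) • signedVec G) r = level ω r := by
      ext a
      rw [mem_level, mem_level]
      by_cases h1 : a ∈ G
      · have := hmin a h1
        rw [hin a h1]
        constructor <;> intro <;> linarith
      by_cases h2 : a.swap ∈ G
      · obtain ⟨h3, h4⟩ := hneg a h2
        rw [h4]
        constructor <;> intro <;> linarith
      · rw [hout a h1 h2]
    rw [this]
    refine ⟨level_mem_levels ω hr, ?_⟩
    rintro (h : _ = G)
    apply hb₀
    rw [← h, mem_level]
    rcases le_total (signedVal ω b₀) 0 with h0 | h0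
    · rw [hu, max_eq_right h0] at hru
      linarith
    · rwa [hu, max_eq_left h0] at hru
  · have : level (ω - (t - u) • signedVec G) r = level ω (r + (t - u)) := by
      ext a
      rw [mem_level, mem_level]
      by_cases h1 : a ∈ G
      · rw [hin a h1]
        constructor <;> intro <;> linarith
      by_cases h2 : a.swap ∈ G
      · obtain ⟨h3, h4⟩ := hneg a h2
        rw [h4]
        constructor <;> intro <;> linarith
      · have := hub a h1
        rw [hout a h1 h2]
        constructor <;> intro <;> linarith
    rw [this]
    refine ⟨level_mem_levels ω (by linarith), ?_⟩
    rintro (h : _ = G)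
    rw [← h, mem_level] at ha₀
    linarith

theorem eq_zero_of_levels_subset {ω : Fin n → ℝ} (h : levels ω ⊆ {∅}) : ω = 0 := by
  have h1 : ∀ a, signedVal ω a ≤ 0 := by
    intro a
    by_contra! ha
    have h2 : level ω (signedVal ω a) = ∅ := h (level_mem_levels ω ha)
    have h3 : a ∈ level ω (signedVal ω a) := mem_level.2 le_rfl
    rw [h2] at h3
    exact h3
  funext i
  have h2 := h1 (Sum.inl i)
  have h3 := h1 (Sum.inr i)
  simp only [signedVal, Sum.elim_inl, Sum.elim_inr] at h2 h3
  simp only [Pi.zero_apply]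
  linarith

/-- Peel off one level set at a time; the number of levels drops until the vector is zero. No chain
hypothesis is needed, since `levels ω` is a chain by itself. -/
theorem mem_hull_of_levels_subset {ω : Fin n → ℝ} {𝓕 : Set (Set (SignedGround n))}
    (h : levels ω ⊆ insert ∅ 𝓕) : ω ∈ PointedCone.hull ℝ (signedVec '' 𝓕) := by
  induction hk : (levels ω).ncard using Nat.strong_induction_on generalizing ω with
  | _ k ih =>
    by_cases h0 : levels ω ⊆ {∅}
    · rw [eq_zero_of_levels_subset h0]
      exact Submodule.zero_mem _
    · obtain ⟨G, hG, hG0⟩ := Set.not_subset.1 h0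
      obtain ⟨ε, hε, hsub⟩ := exists_levels_sub_subset hG (Set.nonempty_iff_ne_empty.2 hG0)
      have h1 := ih _ (by
        rw [← hk]
        exact Set.ncard_lt_ncard ((Set.ssubset_iff_of_subset (hsub.trans Set.sdiff_subset)).2
          ⟨G, hG, fun h => (hsub h).2 rfl⟩) (Set.toFinite _))
        (hsub.trans (Set.sdiff_subset.trans h)) rfl
      have h2 : signedVec G ∈ PointedCone.hull ℝ (signedVec '' 𝓕) :=
        PointedCone.subset_hull ⟨G, (h hG).resolve_left hG0, rfl⟩
      have h3 := Submodule.add_mem _ h1 (Submodule.smul_mem _ (⟨ε, hε.le⟩ : NNReal) h2)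
      have h4 : (⟨ε, hε.le⟩ : NNReal) • signedVec G = ε • signedVec G := rfl
      rwa [h4, sub_add_cancel] at h3

theorem level_eq_setOf_max {ω : Fin n → ℝ} {t : ℝ} (ht : 0 < t) :
    level ω t = {a | t ≤ max (signedVal ω a) 0} := by
  ext a
  simp [mem_level, ht.not_ge]

/-! ### Vectors whose level sets form a common chain. -/

section Comonotone

variable {x y : Fin n → ℝ}

theorem comonotone_of_isChain (h : IsChain (· ⊆ ·) (levels x ∪ levels y)) (a b : SignedGround n)
    (hab : max (signedVal x b) 0 < max (signedVal x a) 0) :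
    max (signedVal y b) 0 ≤ max (signedVal y a) 0 := by
  by_contra! hlt
  have hpx := (le_max_right (signedVal x b) 0).trans_lt hab
  have hpy := (le_max_right (signedVal y a) 0).trans_lt hlt
  rcases h.total (Or.inl (level_mem_levels x hpx)) (Or.inr (level_mem_levels y hpy)) with h | h
  · rw [level_eq_setOf_max hpx, level_eq_setOf_max hpy] at h
    exact hlt.not_ge (h (Set.mem_ofPred_eq.ge le_rfl))
  · rw [level_eq_setOf_max hpx, level_eq_setOf_max hpy] at h
    exact hab.not_ge (h (Set.mem_ofPred_eq.ge le_rfl))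

/-- Vectors in a common chain never have opposite signs at a point, so positive parts add. -/
theorem signedVal_nonneg_of_isChain (h : IsChain (· ⊆ ·) (levels x ∪ levels y))
    {a : SignedGround n} (ha : 0 < signedVal x a) : 0 ≤ signedVal y a := by
  by_contra! hy
  have hy' : 0 < signedVal y a.swap := by
    rw [signedVal_swap]
    linarith
  have h1 : a ∈ level x (signedVal x a) := mem_level.2 le_rfl
  have h2 : a.swap ∈ level y (signedVal y a.swap) := mem_level.2 le_rfl
  have hx := level_mem_levels x ha
  have hy := level_mem_levels y hy'
  rcases h.total (Or.inl hx) (Or.inr hy) with h | h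
  · exact admissibleSet_of_mem_levels hy a (h h1) h2
  · exact admissibleSet_of_mem_levels hx a h1 (h h2)

theorem level_add_of_isChain (h : IsChain (· ⊆ ·) (levels x ∪ levels y)) {t : ℝ} (ht : 0 < t) :
    level (x + y) t = {a | t ≤ max (signedVal x a) 0 + max (signedVal y a) 0} := by
  ext a
  rw [mem_level, signedVal_add, Set.mem_ofPred_eq]
  rcases lt_or_ge 0 (signedVal x a) with h1 | h1
  · rw [max_eq_left h1.le, max_eq_left (signedVal_nonneg_of_isChain h h1)]
  rcases lt_or_ge 0 (signedVal y a) with h2 | h2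
  · rw [max_eq_left h2.le, max_eq_left]
    exact signedVal_nonneg_of_isChain (Set.union_comm _ _ ▸ h) h2
  · rw [max_eq_right h1, max_eq_right h2]
    constructor <;> intro <;> linarith

/-- By comonotonicity a level set of the sum is an intersection of superlevel sets of the two
positive parts, and nesting makes this one of the two. -/
theorem levels_add_subset (h : IsChain (· ⊆ ·) (levels x ∪ levels y)) :
    levels (x + y) ⊆ levels x ∪ levels y := by
  rintro _ ⟨t, ht, rfl⟩
  rw [level_add_of_isChain h ht]
  have hxy := comonotone_of_isChain h
  rcases Set.eq_empty_or_nonempty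
    {a | t ≤ max (signedVal x a) 0 + max (signedVal y a) 0} with he | he
  · rw [he]
    exact Or.inl (empty_mem_levels x)
  obtain ⟨a, ha, hmin⟩ := Set.exists_min_image _
    (fun a => max (signedVal x a) 0 + max (signedVal y a) 0) (Set.toFinite _) he
  have hS : {a | t ≤ max (signedVal x a) 0 + max (signedVal y a) 0} =
      {b | max (signedVal x a) 0 ≤ max (signedVal x b) 0} ∩
        {b | max (signedVal y a) 0 ≤ max (signedVal y b) 0} := by
    ext b
    constructor
    · intro hb
      have h1 := hmin b hb
      constructor
      · by_contra! hlt
        simp only [Set.mem_ofPred_eq, not_le] at hlt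
        have := hxy a b hlt
        linarith
      · by_contra! hlt
        simp only [Set.mem_ofPred_eq, not_le] at hlt
        have h2 : max (signedVal x a) 0 < max (signedVal x b) 0 := by linarith
        have := hxy b a h2
        linarith
    · rintro ⟨h1, h2⟩
      rw [Set.mem_ofPred_eq] at h1 h2 ha ⊢
      exact ha.trans (add_le_add h1 h2)
  rw [hS]
  have h0 : ∀ (z : Fin n → ℝ) b, (0 : ℝ) ≤ max (signedVal z b) 0 := fun z b => le_max_right _ _
  rcases (h0 x a).eq_or_lt with hx | hx
  · rcases (h0 y a).eq_or_lt with hy | hy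
    · have ha' : t ≤ max (signedVal x a) 0 + max (signedVal y a) 0 := ha
      linarith
    · right
      rw [← hx, ← level_eq_setOf_max hy, Set.inter_eq_self_of_subset_right]
      · exact level_mem_levels y hy
      · exact fun b _ => h0 x b
  · rcases (h0 y a).eq_or_lt with hy | hy
    · left
      rw [← hy, ← level_eq_setOf_max hx, Set.inter_eq_self_of_subset_left]
      · exact level_mem_levels x hx
      · exact fun b _ => h0 y b
    · rw [← level_eq_setOf_max hx, ← level_eq_setOf_max hy]
      have hlx := level_mem_levels x hx
      have hly := level_mem_levels y hy
      rcases h.total (Or.inl hlx) (Or.inr hly) with h | h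
      · rw [Set.inter_eq_self_of_subset_left h]
        exact Or.inl hlx
      · rw [Set.inter_eq_self_of_subset_right h]
        exact Or.inr hly

theorem levels_subset_levels_add (h : IsChain (· ⊆ ·) (levels x ∪ levels y)) :
    levels x ⊆ levels (x + y) := by
  rintro _ ⟨t, ht, rfl⟩
  have hxy := comonotone_of_isChain h
  rw [level_eq_setOf_max ht]
  rcases Set.eq_empty_or_nonempty {a | t ≤ max (signedVal x a) 0} with he | he
  · rw [he]
    exact empty_mem_levels _
  obtain ⟨a₀, ha₀, hmin₀⟩ := Set.exists_min_image _
    (fun a => max (signedVal x a) 0) (Set.toFinite _) he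
  -- Ties in `x` are broken by the least `y`; the threshold of the sum at this point cuts out the
  -- given level of `x`.
  obtain ⟨a, ha, hmin⟩ := Set.exists_min_image
    {a | max (signedVal x a) 0 = max (signedVal x a₀) 0}
    (fun a => max (signedVal y a) 0) (Set.toFinite _) ⟨a₀, rfl⟩
  have ha' : max (signedVal x a) 0 = max (signedVal x a₀) 0 := ha
  have hta : t ≤ max (signedVal x a) 0 := by
    rw [ha']
    exact ha₀
  have hy0 : 0 ≤ max (signedVal y a) 0 := le_max_right _ _
  have hpos : 0 < max (signedVal x a) 0 + max (signedVal y a) 0 := by linarith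
  refine ⟨_, hpos, ?_⟩
  rw [level_add_of_isChain h hpos]
  ext b
  constructor
  · intro hb
    have h1 : max (signedVal x a) 0 ≤ max (signedVal x b) 0 := by
      rw [ha']
      exact hmin₀ b hb
    refine add_le_add h1 ?_
    rcases h1.eq_or_lt with h2 | h2
    · exact hmin b (h2.symm.trans ha')
    · exact hxy b a h2
  · intro hb
    rw [Set.mem_ofPred_eq] at hb ⊢
    by_contra! hlt
    have h1 := hxy a b (hlt.trans_le hta)
    linarith

end Comonotone

theorem mem_hull_iff_levels_subset {𝓕 : Set (Set (SignedGround n))} (h𝓕 : IsChain (· ⊆ ·) 𝓕)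
    (ha : ∀ F ∈ 𝓕, AdmissibleSet F) {ω : Fin n → ℝ} :
    ω ∈ PointedCone.hull ℝ (signedVec '' 𝓕) ↔ levels ω ⊆ insert ∅ 𝓕 := by
  refine ⟨fun h => ?_, mem_hull_of_levels_subset⟩
  induction h using Submodule.span_induction with
  | mem x hx =>
    obtain ⟨F, hF, rfl⟩ := hx
    refine (levels_signedVec_subset (ha F hF)).trans ?_
    rintro _ (rfl | rfl)
    · exact Set.mem_insert _ _
    · exact Set.mem_insert_of_mem _ hF
  | zero =>
    rintro _ ⟨t, ht, rfl⟩
    rw [level_zero ht]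
    exact Set.mem_insert _ _
  | add x y _ _ hx hy =>
    refine (levels_add_subset ?_).trans (Set.union_subset hx hy)
    exact (h𝓕.insert fun _ _ _ => Or.inl (Set.empty_subset _)).mono (Set.union_subset hx hy)
  | smul c x _ hx => exact (levels_smul_subset c x).trans hx

theorem isChain_levels_union {𝓕 : Set (Set (SignedGround n))} (h𝓕 : IsChain (· ⊆ ·) 𝓕)
    {x y : Fin n → ℝ} (hx : levels x ⊆ insert ∅ 𝓕) (hy : levels y ⊆ insert ∅ 𝓕) :
    IsChain (· ⊆ ·) (levels x ∪ levels y) :=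
  (h𝓕.insert fun _ _ _ => Or.inl (Set.empty_subset _)).mono (Set.union_subset hx hy)

end Levels

/-! ### Normal cones in terms of maximizing bases. -/

section NormalFan

variable {n : ℕ}

/-- The members of `S` whose signed vectors maximize the functional `ω`. -/
def maximizers (S : Set (Set (SignedGround n))) (ω : Fin n → ℝ) : Set (Set (SignedGround n)) :=
  {B | B ∈ S ∧ ∀ B' ∈ S, signedVec B' ⬝ᵥ ω ≤ signedVec B ⬝ᵥ ω}

variable {S : Set (Set (SignedGround n))}

theorem maximizers_nonempty (hS : S.Nonempty) (ω : Fin n → ℝ) : (maximizers S ω).Nonempty := by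
  obtain ⟨B, hB, hmax⟩ := Set.exists_max_image S (fun B => signedVec B ⬝ᵥ ω) (Set.toFinite _) hS
  exact ⟨B, hB, hmax⟩

theorem maximizers_smul_add {x y : Fin n → ℝ} {a : ℝ} (ha : 0 < a)
    (h : (maximizers S x ∩ maximizers S y).Nonempty) :
    maximizers S (a • x + y) = maximizers S x ∩ maximizers S y := by
  obtain ⟨p, hpx, hpy⟩ := h
  ext B
  constructor
  · rintro ⟨hB, hmax⟩
    have h0 := hmax p hpx.1
    simp only [dotProduct_add, dotProduct_smul, smul_eq_mul] at h0
    have h1 := hpx.2 B hB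
    have h2 := hpy.2 B hB
    have h3 := mul_le_mul_of_nonneg_left h1 ha.le
    refine ⟨⟨hB, fun B' hB' => (hpx.2 B' hB').trans ?_⟩,
      ⟨hB, fun B' hB' => (hpy.2 B' hB').trans (by linarith)⟩⟩
    exact le_of_mul_le_mul_left (by linarith) ha
  · rintro ⟨⟨hB, hx⟩, -, hy⟩
    refine ⟨hB, fun B' hB' => ?_⟩
    simp only [dotProduct_add, dotProduct_smul, smul_eq_mul]
    exact add_le_add (mul_le_mul_of_nonneg_left (hx B' hB') ha.le) (hy B' hB')

theorem dotProduct_le_of_forall_signedVec {ν : Fin n → ℝ} {m : ℝ}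
    (h : ∀ B ∈ S, signedVec B ⬝ᵥ ν ≤ m) {x : Fin n → ℝ} (hx : x ∈ matroidPolytope S) :
    x ⬝ᵥ ν ≤ m := by
  have hc : Convex ℝ {x : Fin n → ℝ | x ⬝ᵥ ν ≤ m} := by
    intro x hx y hy a b ha hb hab
    rw [Set.mem_ofPred_eq] at hx hy ⊢
    rw [add_dotProduct, smul_dotProduct, smul_dotProduct, smul_eq_mul, smul_eq_mul]
    have h1 := mul_le_mul_of_nonneg_left hx ha
    have h2 := mul_le_mul_of_nonneg_left hy hb
    have h3 : a * m + b * m = m := by rw [← add_mul, hab, one_mul]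
    linarith
  refine convexHull_min ?_ hc hx
  rintro _ ⟨B, hB, rfl⟩
  exact h B hB

/-- Where `B` is not optimal for `ω` the gap is positive, so a large multiple of it dominates the
difference in `ν`; finitely many `B` allow one constant. Membership in normal cones can then be
tested at vertices, without describing faces as hulls. -/
theorem exists_pos_forall_dotProduct_le {ω ν : Fin n → ℝ} {B₀ : Set (SignedGround n)}
    (hB₀ : B₀ ∈ maximizers S ω) (h : maximizers S ω ⊆ maximizers S ν) :
    ∃ C : ℝ, 0 < C ∧ ∀ B ∈ S, signedVec B ⬝ᵥ (C • ω - ν) ≤ signedVec B₀ ⬝ᵥ (C • ω - ν) := by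
  have key : ∀ B : Set (SignedGround n), ∃ c : ℝ, B ∈ S → ∀ C, c ≤ C →
      signedVec B ⬝ᵥ (C • ω - ν) ≤ signedVec B₀ ⬝ᵥ (C • ω - ν) := by
    intro B
    by_cases hB : B ∈ S
    swap
    · exact ⟨0, fun h => absurd h hB⟩
    simp only [dotProduct_sub, dotProduct_smul, smul_eq_mul]
    have h1 := hB₀.2 B hB
    rcases h1.eq_or_lt with h2 | h2
    · have h3 : B ∈ maximizers S ω := ⟨hB, fun B' hB' => h2 ▸ hB₀.2 B' hB'⟩
      have h4 := (h h3).2 B₀ hB₀.1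
      refine ⟨0, fun _ C _ => ?_⟩
      rw [h2]
      linarith
    · refine ⟨(signedVec B₀ ⬝ᵥ ν - signedVec B ⬝ᵥ ν) / (signedVec B₀ ⬝ᵥ ω - signedVec B ⬝ᵥ ω),
        fun _ C hC => ?_⟩
      rw [div_le_iff₀ (sub_pos.2 h2)] at hC
      linarith
  choose c hc using key
  obtain ⟨C, hC⟩ := (Set.finite_range c).bddAbove
  refine ⟨max C 1, by positivity, fun B hB => hc B hB _ ?_⟩
  exact (hC ⟨B, rfl⟩).trans (le_max_left _ _)

theorem mem_normalCone_iff (hS : S.Nonempty) {ω ν : Fin n → ℝ} :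
    ν ∈ normalCone (matroidPolytope S) ω ↔ maximizers S ω ⊆ maximizers S ν := by
  have hsub : ∀ B ∈ S, signedVec B ∈ matroidPolytope S := fun B hB =>
    subset_convexHull ℝ _ ⟨B, hB, rfl⟩
  constructor
  · intro h B hB
    have h1 : signedVec B ∈ maxFace (matroidPolytope S) ω :=
      ⟨hsub B hB.1, fun y hy => dotProduct_le_of_forall_signedVec hB.2 hy⟩
    exact ⟨hB.1, fun B' hB' => (h h1).2 _ (hsub B' hB')⟩
  · intro h x hx
    refine ⟨hx.1, fun y hy => ?_⟩
    obtain ⟨B₀, hB₀⟩ := maximizers_nonempty hS ω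
    obtain ⟨C, hC, hle⟩ := exists_pos_forall_dotProduct_le hB₀ h
    have h1 := dotProduct_le_of_forall_signedVec hle hx.1
    have h2 := dotProduct_le_of_forall_signedVec (h hB₀).2 hy
    have h3 := mul_le_mul_of_nonneg_left (hx.2 _ (hsub B₀ hB₀.1)) hC.le
    simp only [dotProduct_sub, dotProduct_smul, smul_eq_mul] at h1
    linarith

theorem normalCone_eq_of_maximizers_eq (hS : S.Nonempty) {ω ν : Fin n → ℝ}
    (h : maximizers S ω = maximizers S ν) :
    normalCone (matroidPolytope S) ω = normalCone (matroidPolytope S) ν := by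
  ext μ
  rw [mem_normalCone_iff hS, mem_normalCone_iff hS, h]

theorem finite_normalFan (hS : S.Nonempty) : (normalFan (matroidPolytope S)).Finite := by
  -- A normal cone depends only on its set of maximizers, and there are finitely many such sets.
  refine Set.Finite.subset (Set.finite_range fun V : Set (Set (SignedGround n)) =>
    normalCone (matroidPolytope S) (Classical.epsilon fun ω => maximizers S ω = V)) ?_
  rintro _ ⟨ω, rfl⟩
  refine ⟨maximizers S ω, normalCone_eq_of_maximizers_eq hS ?_⟩
  exact Classical.epsilon_spec (p := fun ν => maximizers S ν = maximizers S ω) ⟨ω, rfl⟩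

theorem inf_normalCone_isFaceOf (hS : S.Nonempty) (ω ω' : Fin n → ℝ) :
    (normalCone (matroidPolytope S) ω ⊓ normalCone (matroidPolytope S) ω').IsFaceOf
      (normalCone (matroidPolytope S) ω) := by
  refine ⟨inf_le_left, ?_⟩
  intro x y a hx hy ha hxy
  refine ⟨hx, ?_⟩
  have h := (Submodule.mem_inf.1 hxy).2
  rw [mem_normalCone_iff hS] at hx hy h
  rw [maximizers_smul_add ha ((maximizers_nonempty hS ω).mono (Set.subset_inter hx hy))] at h
  exact (mem_normalCone_iff hS).2 (h.trans Set.inter_subset_left)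

/-- A point `ν` of `τ` with fewest maximizers plays the role of a relative interior point. Any `μ`
in its normal cone satisfies `C • ν = μ + (C • ν - μ)` with both summands in the big cone, so the
face property puts `μ` in `τ`. -/
theorem exists_eq_normalCone_of_isFaceOf (hS : S.Nonempty) {ω : Fin n → ℝ}
    {τ : PointedCone ℝ (Fin n → ℝ)} (hτ : τ.IsFaceOf (normalCone (matroidPolytope S) ω)) :
    ∃ ν ∈ τ, τ = normalCone (matroidPolytope S) ν := by
  obtain ⟨ν, hν, hmin⟩ := Nat.sInf_mem
    (s := (fun ν => (maximizers S ν).ncard) '' (τ : Set (Fin n → ℝ))) ⟨_, 0, τ.zero_mem, rfl⟩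
  replace hmin : ∀ μ ∈ τ, (maximizers S ν).ncard ≤ (maximizers S μ).ncard := fun μ hμ =>
    hmin.trans_le (Nat.sInf_le ⟨μ, hμ, rfl⟩)
  have hω : ∀ μ ∈ τ, maximizers S ω ⊆ maximizers S μ := fun μ hμ =>
    (mem_normalCone_iff hS).1 (hτ.le hμ)
  refine ⟨ν, hν, le_antisymm (fun μ hμ => ?_) fun μ hμ => ?_⟩
  · rw [mem_normalCone_iff hS]
    have h1 := hmin _ (τ.add_mem hν hμ)
    have h2 := maximizers_smul_add one_pos
      ((maximizers_nonempty hS ω).mono (Set.subset_inter (hω ν hν) (hω μ hμ)))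
    rw [one_smul] at h2
    rw [h2] at h1
    exact Set.inter_eq_left.1
      (Set.eq_of_subset_of_ncard_le Set.inter_subset_left h1 (Set.toFinite _))
  · rw [mem_normalCone_iff hS] at hμ
    obtain ⟨B₀, hB₀⟩ := maximizers_nonempty hS ω
    obtain ⟨C, hC, hC'⟩ := exists_pos_forall_dotProduct_le (hω ν hν hB₀) hμ
    have hmem : C • ν - μ ∈ normalCone (matroidPolytope S) ω := by
      rw [mem_normalCone_iff hS]
      intro B hB
      have h1 := (hω ν hν hB).2 B₀ hB₀.1
      have h2 := (hω ν hν hB₀).2 B hB.1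
      have h3 := (hμ (hω ν hν hB)).2 B₀ hB₀.1
      have h4 := (hμ (hω ν hν hB₀)).2 B hB.1
      refine ⟨hB.1, fun B' hB' => (hC' B' hB').trans (le_of_eq ?_)⟩
      simp only [dotProduct_sub, dotProduct_smul, smul_eq_mul]
      rw [le_antisymm h1 h2, le_antisymm h3 h4]
    refine hτ.mem_of_smul_add_mem (a := 1) ?_ hmem one_pos ?_
    · exact (mem_normalCone_iff hS).2 ((hω ν hν).trans hμ)
    · rw [one_smul, add_sub_cancel]
      exact τ.smul_mem hC.le hν

end NormalFan

/-! ### Maximizing bases and level sets. -/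

section Maximizers

variable {n : ℕ}

theorem signedVec_dotProduct_signedVec (B G : Set (SignedGround n)) :
    signedVec B ⬝ᵥ signedVec G = (B ∩ G).ncard - (B ∩ Sum.swap ⁻¹' G).ncard := by
  classical
  have h : ∀ A : Set (SignedGround n),
      (A.ncard : ℝ) = ∑ a : SignedGround n, if a ∈ A then (1 : ℝ) else 0 := by
    intro A
    rw [Finset.sum_boole, Set.ncard_eq_toFinset_card']
    congr 2
    ext a
    simp
  rw [h, h, ← Finset.sum_sub_distrib, Fintype.sum_sum_type, ← Finset.sum_add_distrib]
  refine Finset.sum_congr rfl fun i _ => ?_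
  by_cases h1 : (Sum.inl i : SignedGround n) ∈ B <;>
    by_cases h2 : (Sum.inr i : SignedGround n) ∈ B <;>
    by_cases h3 : (Sum.inl i : SignedGround n) ∈ G <;>
    by_cases h4 : (Sum.inr i : SignedGround n) ∈ G <;>
    simp [signedVec, h1, h2, h3, h4]

theorem signedVec_empty : signedVec (∅ : Set (SignedGround n)) = 0 := by
  funext i
  simp [signedVec]

theorem mem_maximizers_zero {S : Set (Set (SignedGround n))} {B : Set (SignedGround n)}
    (hB : B ∈ S) : B ∈ maximizers S 0 :=
  ⟨hB, fun B' _ => by simp⟩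

/-- The admissible bases of a matroid on the signed ground set. -/
def admissibleBases (M : Matroid (SignedGround n)) : Set (Set (SignedGround n)) :=
  {B | M.IsBase B ∧ AdmissibleSet B}

variable {M : Matroid (SignedGround n)}

theorem IsAdmissibleMatroid.mem_maximizers_signedVec_iff (hM : IsAdmissibleMatroid M)
    (hr : M.natRk Set.univ ≤ n) {G : Set (SignedGround n)} (hG : AdmissibleSet G)
    {B : Set (SignedGround n)} (hB : B ∈ admissibleBases M) :
    B ∈ maximizers (admissibleBases M) (signedVec G) ↔
      (B ∩ G).ncard = M.natRk G ∧ (B ∩ Sum.swap ⁻¹' G).ncard = M.defect G := by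
  have hb : ∀ B ∈ admissibleBases M, (B ∩ G).ncard ≤ M.natRk G ∧
      M.defect G ≤ (B ∩ Sum.swap ⁻¹' G).ncard := fun B hB =>
    ⟨(hB.1.indep.subset Set.inter_subset_left).ncard_le_natRk Set.inter_subset_right,
      defect_le_ncard hM.ground_eq hG hB.1 hB.2⟩
  constructor
  · rintro ⟨-, hmax⟩
    obtain ⟨B₀, h1, h2, h3⟩ := hM.exists_isBase_of_isChain hr (𝓖 := {G})
      IsChain.singleton (by simpa using hG)
    obtain ⟨h4, h5⟩ := h3 G rfl
    have h6 := hmax B₀ ⟨h1, h2⟩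
    obtain ⟨h7, h8⟩ := hb B hB
    rw [signedVec_dotProduct_signedVec, signedVec_dotProduct_signedVec, h4, h5,
      sub_le_sub_iff] at h6
    norm_cast at h6
    omega
  · rintro ⟨h1, h2⟩
    refine ⟨hB, fun B' hB' => ?_⟩
    obtain ⟨h3, h4⟩ := hb B' hB'
    rw [signedVec_dotProduct_signedVec, signedVec_dotProduct_signedVec, h1, h2, sub_le_sub_iff]
    norm_cast
    omega

theorem mem_maximizers_of_forall_levels {S : Set (Set (SignedGround n))}
    {B : Set (SignedGround n)} (hB : B ∈ S) {ω : Fin n → ℝ}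
    (h : ∀ G ∈ levels ω, B ∈ maximizers S (signedVec G)) : B ∈ maximizers S ω := by
  have hω : ω ∈ PointedCone.hull ℝ (signedVec '' levels ω) :=
    mem_hull_of_levels_subset (Set.subset_insert _ _)
  generalize levels ω = 𝓕 at h hω
  induction hω using Submodule.span_induction with
  | mem x hx =>
    obtain ⟨G, hG, rfl⟩ := hx
    exact h G hG
  | zero => exact mem_maximizers_zero hB
  | add x y _ _ hx hy =>
    have := maximizers_smul_add one_pos ⟨B, hx, hy⟩
    rw [one_smul] at this
    rw [this]
    exact ⟨hx, hy⟩
  | smul c x _ hx =>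
    rcases eq_or_ne c 0 with rfl | hc
    · rw [zero_smul]
      exact mem_maximizers_zero hB
    · have hc' : (0 : ℝ) < c := lt_of_le_of_ne c.2 fun h => hc (Subtype.ext h.symm)
      have := maximizers_smul_add hc' ⟨B, hx, mem_maximizers_zero hB⟩
      rw [add_zero] at this
      exact this.ge ⟨hx, mem_maximizers_zero hB⟩

/-- Some base is optimal for all level sets at once. Hence, when `ω` is split as a positive multiple
of the signed vector of `G` plus a vector with fewer levels, the two summands have a common
maximizer, and a maximizer of the sum maximizes both. -/
theorem IsAdmissibleMatroid.mem_maximizers_iff (hM : IsAdmissibleMatroid M)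
    (hr : M.natRk Set.univ ≤ n) {ω : Fin n → ℝ} {B : Set (SignedGround n)}
    (hB : B ∈ admissibleBases M) : B ∈ maximizers (admissibleBases M) ω ↔
      ∀ G ∈ levels ω, B ∈ maximizers (admissibleBases M) (signedVec G) := by
  refine ⟨fun h G hG => ?_, mem_maximizers_of_forall_levels hB⟩
  rcases Set.eq_empty_or_nonempty G with rfl | hne
  · rw [signedVec_empty]
    exact mem_maximizers_zero hB
  obtain ⟨B₀, h1, h2, h3⟩ := hM.exists_isBase_of_isChain hr (isChain_levels ω)
    fun G hG => admissibleSet_of_mem_levels hG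
  have hB₀ : B₀ ∈ admissibleBases M := ⟨h1, h2⟩
  have hB₀' : ∀ G ∈ levels ω, B₀ ∈ maximizers (admissibleBases M) (signedVec G) := fun G hG =>
    (hM.mem_maximizers_signedVec_iff hr (admissibleSet_of_mem_levels hG) hB₀).2 (h3 G hG)
  obtain ⟨ε, hε, hsub⟩ := exists_levels_sub_subset hG hne
  have h4 := maximizers_smul_add hε ⟨B₀, hB₀' G hG, mem_maximizers_of_forall_levels hB₀
    fun G' hG' => hB₀' G' (hsub hG').1⟩
  rw [add_sub_cancel] at h4
  rw [h4] at h
  exact h.1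

/-- The vectors all of whose positive level sets are flats. -/
def flatVectors (M : Matroid (SignedGround n)) : Set (Fin n → ℝ) :=
  {ω | ∀ G ∈ levels ω, M.IsFlat G}

/-- The points above `x` form a level set `A`, and `A ∪ {x}` fits into the chain of levels. A base
optimal for the enlarged chain must contain `x`, because `A` is a flat without `x`. -/
theorem IsAdmissibleMatroid.exists_mem_maximizers_mem (hM : IsAdmissibleMatroid M)
    (hr : M.natRk Set.univ ≤ n) {ω : Fin n → ℝ} (hω : ω ∈ flatVectors M) {x : SignedGround n}
    (hx : 0 ≤ signedVal ω x) : ∃ B ∈ maximizers (admissibleBases M) ω, x ∈ B := by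
  set A : Set (SignedGround n) := {a | signedVal ω x < signedVal ω a} with hA
  have hAl : A ∈ levels ω := setOf_lt_signedVal_mem_levels ω hx
  have hxA : x ∉ A := by simp [hA]
  have hD : AdmissibleSet (insert x A) := by
    refine (admissibleSet_of_mem_levels hAl).insert fun h => ?_
    rw [hA, Set.mem_ofPred_eq, signedVal_swap] at h
    linarith
  have hchain : IsChain (· ⊆ ·) (insert (insert x A) (levels ω)) := by
    refine (isChain_levels ω).insert ?_
    rintro _ ⟨t, ht, rfl⟩ -
    rcases le_or_gt t (signedVal ω x) with h | h
    · left
      rintro a (rfl | ha)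
      · exact h
      · rw [hA, Set.mem_ofPred_eq] at ha
        exact h.trans ha.le
    · right
      intro a ha
      rw [mem_level] at ha
      right
      rw [hA, Set.mem_ofPred_eq]
      exact h.trans_le ha
  obtain ⟨B, h1, h2, h3⟩ := hM.exists_isBase_of_isChain hr hchain (by
    rintro G (rfl | hG)
    exacts [hD, admissibleSet_of_mem_levels hG])
  have hB : B ∈ admissibleBases M := ⟨h1, h2⟩
  refine ⟨B, (hM.mem_maximizers_iff hr hB).2 fun G hG => (hM.mem_maximizers_signedVec_iff hr
    (admissibleSet_of_mem_levels hG) hB).2 (h3 G (Or.inr hG)), ?_⟩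
  by_contra hxB
  have h4 := (h3 _ (Or.inl rfl)).1
  rw [Set.inter_insert_of_notMem hxB] at h4
  have h5 := (h1.indep.subset (Set.inter_subset_left (t := A))).isBasis_of_natRk_le hM.ground_eq
    (Set.inter_subset_right.trans (Set.subset_insert x A)) h4.ge
  have h6 : x ∈ M.closure A :=
    M.closure_subset_closure Set.inter_subset_right (h5.subset_closure (Set.mem_insert _ _))
  rw [(hω A hAl).closure] at h6
  exact hxA h6

/-- A non-flat level `G` of `ν` has defect zero, so every maximizer of `ω` avoids `G*` and `cl(G) \
G`. But each point where `ω` is nonnegative lies in some maximizer. Thus `ω` is positive on `G`,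
hence on its closure since the positive set of `ω` is a flat, and a point of `cl(G) \ G` gives a
contradiction. -/
theorem IsAdmissibleMatroid.flatVectors_of_maximizers_subset (hM : IsAdmissibleMatroid M)
    (hr : M.natRk Set.univ ≤ n) {ω ν : Fin n → ℝ} (hω : ω ∈ flatVectors M)
    (h : maximizers (admissibleBases M) ω ⊆ maximizers (admissibleBases M) ν) :
    ν ∈ flatVectors M := by
  intro G hG
  by_contra hGf
  have hGa := admissibleSet_of_mem_levels hG
  have hsub : G ⊆ M.closure G := M.subset_closure _ (by simp [hM.ground_eq])
  have hdef : M.defect G = 0 := by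
    have := hM.natRk_add_ncard_le_of_not_isFlat hGa hGf
    rw [Matroid.defect, if_neg (by omega)]
  have key : ∀ B ∈ maximizers (admissibleBases M) ω,
      (∀ g ∈ G, g.swap ∉ B) ∧ ∀ x ∈ M.closure G, x ∉ G → x ∉ B := by
    intro B hB
    have h1 := (hM.mem_maximizers_iff hr hB.1).1 (h hB) G hG
    obtain ⟨h2, h3⟩ := (hM.mem_maximizers_signedVec_iff hr hGa hB.1).1 h1
    rw [hdef, Set.ncard_eq_zero (Set.toFinite _)] at h3
    refine ⟨fun g hg hgB => ?_, fun x hx hxG hxB => ?_⟩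
    · have : g.swap ∈ B ∩ Sum.swap ⁻¹' G := ⟨hgB, by simpa using hg⟩
      rw [h3] at this
      exact this
    · have hi := hB.1.1.indep
      have hb := (hi.subset Set.inter_subset_left).isBasis_of_natRk_le hM.ground_eq
        (Set.inter_subset_right (s := B) (t := G)) h2.ge
      rw [← hb.closure_eq_closure] at hx
      have h4 : x ∉ B ∩ G := fun h => hxG h.2
      have h5 : M.Indep (insert x (B ∩ G)) :=
        hi.subset (Set.insert_subset hxB Set.inter_subset_left)
      rw [(hi.subset Set.inter_subset_left).insert_indep_iff_of_notMem h4] at h5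
      exact h5.2 hx
  have hpos : G ⊆ {a | 0 < signedVal ω a} := by
    intro g hg
    by_contra hle
    rw [Set.mem_ofPred_eq, not_lt] at hle
    obtain ⟨B, hB, hgB⟩ := hM.exists_mem_maximizers_mem hr hω (x := g.swap) (by
      rw [signedVal_swap]
      linarith)
    exact (key B hB).1 g hg hgB
  have hcl : M.closure G ⊆ {a | 0 < signedVal ω a} := by
    rw [← (hω _ (setOf_lt_signedVal_mem_levels ω le_rfl)).closure]
    exact M.closure_subset_closure hpos
  obtain ⟨x, hx, hxG⟩ : ∃ x ∈ M.closure G, x ∉ G := by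
    by_contra! h
    exact hGf (hsub.antisymm h ▸ M.isFlat_closure G)
  have hx0 := hcl hx
  rw [Set.mem_ofPred_eq] at hx0
  obtain ⟨B, hB, hxB⟩ := hM.exists_mem_maximizers_mem hr hω hx0.le
  exact (key B hB).2 x hx hxG hxB

end Maximizers

/-! ### The Bergman fan and its comparison with the normal fan. -/

section BergmanFan

variable {n : ℕ} {M : Matroid (SignedGround n)}

theorem isFlat_and_admissibleSet_of_mem {F : Set (SignedGround n)}
    (hF : F ∈ latticeOfFlats M \ {∅, Set.univ}) : M.IsFlat F ∧ AdmissibleSet F := by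
  rcases hF.1 with h | h
  · exact h
  · exact absurd (Or.inr h) hF.2

theorem mem_latticeOfFlats_sdiff {F : Set (SignedGround n)} (hF : M.IsFlat F)
    (hFa : AdmissibleSet F) (hne : F ≠ ∅) : F ∈ latticeOfFlats M \ {∅, Set.univ} := by
  refine ⟨Or.inl ⟨hF, hFa⟩, ?_⟩
  rintro (h | h)
  · exact hne h
  · obtain ⟨a, ha⟩ := Set.nonempty_iff_ne_empty.2 hne
    refine hFa a ha ?_
    rw [h]
    exact Set.mem_univ _

theorem bergmanFan_isFan (M : Matroid (SignedGround n)) : IsFan (bergmanFan M) := by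
  have hface : ∀ σ ∈ bergmanFan M, ∀ τ ∈ bergmanFan M, (σ ⊓ τ).IsFaceOf σ := by
    rintro _ ⟨𝓕, h𝓕, hc, rfl⟩ _ ⟨𝓖, h𝓖, hc', rfl⟩
    have ha : ∀ F ∈ 𝓕, AdmissibleSet F := fun F hF => (isFlat_and_admissibleSet_of_mem (h𝓕 hF)).2
    have ha' : ∀ F ∈ 𝓖, AdmissibleSet F := fun F hF => (isFlat_and_admissibleSet_of_mem (h𝓖 hF)).2
    refine ⟨inf_le_left, ?_⟩
    intro x y a hx hy h0 hxy
    refine ⟨hx, ?_⟩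
    have h1 := (Submodule.mem_inf.1 hxy).2
    have hax := PointedCone.smul_mem _ h0.le hx
    have hx' : x ∈ PointedCone.hull ℝ (signedVec '' 𝓖) ↔
        a • x ∈ PointedCone.hull ℝ (signedVec '' 𝓖) := by
      refine ⟨PointedCone.smul_mem _ h0.le, fun h => ?_⟩
      have := PointedCone.smul_mem _ (inv_nonneg.2 h0.le) h
      rwa [inv_smul_smul₀ h0.ne'] at this
    refine hx'.2 ?_
    rw [mem_hull_iff_levels_subset hc ha] at hax hy
    rw [mem_hull_iff_levels_subset hc' ha'] at h1 ⊢
    exact (levels_subset_levels_add (isChain_levels_union hc hax hy)).trans h1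
  refine ⟨?_, ?_, ?_, fun σ hσ τ hτ => ⟨hface σ hσ τ hτ, inf_comm τ σ ▸ hface τ hτ σ hσ⟩⟩
  · refine Set.Finite.subset (Set.finite_range fun 𝓕 : Set (Set (SignedGround n)) =>
      PointedCone.hull ℝ (signedVec '' 𝓕)) ?_
    rintro _ ⟨𝓕, -, -, rfl⟩
    exact ⟨𝓕, rfl⟩
  · rintro _ ⟨𝓕, -, -, rfl⟩
    exact Submodule.fg_span (Set.toFinite _)
  · rintro _ ⟨𝓕, h𝓕, hc, rfl⟩ τ hτ
    have ha : ∀ F ∈ 𝓕, AdmissibleSet F := fun F hF => (isFlat_and_admissibleSet_of_mem (h𝓕 hF)).2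
    -- Each nonempty level set of a point of `τ` splits off as a summand within the cone, so its
    -- signed vector lies in the face.
    refine ⟨{F ∈ 𝓕 | signedVec F ∈ τ}, fun F hF => h𝓕 hF.1, hc.mono fun F hF => hF.1, ?_⟩
    apply le_antisymm
    · intro x hx
      refine mem_hull_of_levels_subset fun G hG => ?_
      have hx𝓕 := (mem_hull_iff_levels_subset hc ha).1 (hτ.le hx)
      rcases Set.eq_empty_or_nonempty G with rfl | hne
      · exact Set.mem_insert _ _
      have hG𝓕 : G ∈ 𝓕 := (hx𝓕 hG).resolve_left hne.ne_empty
      refine Or.inr ⟨hG𝓕, ?_⟩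
      obtain ⟨ε, hε, hsub⟩ := exists_levels_sub_subset hG hne
      refine hτ.mem_of_smul_add_mem (a := ε) (PointedCone.subset_hull ⟨G, hG𝓕, rfl⟩)
        (mem_hull_of_levels_subset (hsub.trans (Set.sdiff_subset.trans hx𝓕))) hε ?_
      rwa [add_sub_cancel]
    · refine Submodule.span_le.2 ?_
      rintro _ ⟨F, hF, rfl⟩
      exact hF.2

theorem fanSupport_bergmanFan (hM : IsAdmissibleMatroid M) :
    fanSupport (bergmanFan M) = flatVectors M := by
  have hempty : M.IsFlat ∅ := by
    have := hM.loopless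
    rw [← M.loops_eq_empty]
    exact M.isFlat_closure ∅
  ext ω
  simp only [fanSupport, Set.mem_iUnion, SetLike.mem_coe, exists_prop]
  constructor
  · rintro ⟨_, ⟨𝓕, h𝓕, hc, rfl⟩, hω⟩ G hG
    rw [mem_hull_iff_levels_subset hc fun F hF =>
      (isFlat_and_admissibleSet_of_mem (h𝓕 hF)).2] at hω
    rcases hω hG with rfl | hG
    · exact hempty
    · exact (isFlat_and_admissibleSet_of_mem (h𝓕 hG)).1
  · intro hω
    refine ⟨_, ⟨levels ω \ {∅}, ?_, (isChain_levels ω).mono Set.sdiff_subset, rfl⟩,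
      mem_hull_of_levels_subset ?_⟩
    · rintro G ⟨hG, hne⟩
      exact mem_latticeOfFlats_sdiff (hω G hG) (admissibleSet_of_mem_levels hG) hne
    · intro G hG
      by_cases h : G = ∅
      · exact Or.inl h
      · exact Or.inr ⟨hG, h⟩

theorem IsAdmissibleMatroid.mem_normalCone_signedVec (hM : IsAdmissibleMatroid M)
    (hr : M.natRk Set.univ ≤ n) (hne : (admissibleBases M).Nonempty) {ω : Fin n → ℝ}
    {G : Set (SignedGround n)} (hG : G ∈ levels ω) :
    signedVec G ∈ normalCone (matroidPolytope (admissibleBases M)) ω := by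
  rw [mem_normalCone_iff hne]
  exact fun B hB => (hM.mem_maximizers_iff hr hB.1).1 hB G hG

/-- Every `ν` in the cone decomposes into signed vectors of its level sets, and these remain in the
cone. So finitely many signed vectors generate it. -/
theorem IsAdmissibleMatroid.normalCone_fg (hM : IsAdmissibleMatroid M)
    (hr : M.natRk Set.univ ≤ n) (hne : (admissibleBases M).Nonempty) (ω : Fin n → ℝ) :
    (normalCone (matroidPolytope (admissibleBases M)) ω).FG := by
  have h : normalCone (matroidPolytope (admissibleBases M)) ω =
      PointedCone.hull ℝ (signedVec ''
        {A | signedVec A ∈ normalCone (matroidPolytope (admissibleBases M)) ω}) := by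
    apply le_antisymm
    · intro ν hν
      refine mem_hull_of_levels_subset fun G hG => Or.inr ?_
      have h1 := hM.mem_normalCone_signedVec hr hne hG
      rw [mem_normalCone_iff hne] at h1 hν
      exact (mem_normalCone_iff hne).2 (hν.trans h1)
    · refine Submodule.span_le.2 ?_
      rintro _ ⟨A, hA, rfl⟩
      exact hA
  rw [h]
  exact Submodule.fg_span (Set.toFinite _)

/-- Choose `ω` in the cone with a maximal family of levels. Adding `μ` loses no level, so by
maximality every level of `μ` is one of `ω`. -/
theorem IsAdmissibleMatroid.exists_le_normalCone (hM : IsAdmissibleMatroid M)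
    (hr : M.natRk Set.univ ≤ n) (hne : (admissibleBases M).Nonempty)
    {σ : PointedCone ℝ (Fin n → ℝ)} (hσ : σ ∈ bergmanFan M) :
    ∃ ω ∈ σ, σ ≤ normalCone (matroidPolytope (admissibleBases M)) ω := by
  obtain ⟨𝓕, h𝓕, hc, rfl⟩ := hσ
  have ha : ∀ F ∈ 𝓕, AdmissibleSet F := fun F hF => (isFlat_and_admissibleSet_of_mem (h𝓕 hF)).2
  have hmem := fun ω => mem_hull_iff_levels_subset (ω := ω) hc ha
  set σ := PointedCone.hull ℝ (signedVec '' 𝓕)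
  obtain ⟨𝓖, hmax⟩ := Set.Finite.exists_maximal (s := levels '' (σ : Set (Fin n → ℝ)))
    (Set.toFinite _) ⟨_, 0, σ.zero_mem, rfl⟩
  obtain ⟨ω, hω, rfl⟩ := hmax.prop
  refine ⟨ω, hω, fun μ hμ => ?_⟩
  have h1 := isChain_levels_union hc ((hmem ω).1 hω) ((hmem μ).1 hμ)
  have h2 := hmax.le_of_ge ⟨ω + μ, σ.add_mem hω hμ, rfl⟩ (levels_subset_levels_add h1)
  have h3 : levels μ ⊆ levels (μ + ω) := levels_subset_levels_add (Set.union_comm _ _ ▸ h1)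
  rw [add_comm] at h3
  rw [mem_normalCone_iff hne]
  exact fun B hB => (hM.mem_maximizers_iff hr hB.1).2 fun G hG =>
    (hM.mem_maximizers_iff hr hB.1).1 hB G (h2 (h3 hG))

end BergmanFan

theorem theorem5p5 (n : ℕ) (S : Set (Set (SignedGround n))) (M : Matroid (SignedGround n))
    (hS : IsRankedSymplectic S M) :
    ∃ X : Set (PointedCone ℝ (Fin n → ℝ)),
      IsSubfan X (normalFan (matroidPolytope S)) ∧ FanRefines (bergmanFan M) X := by
  have hM := hS.admissible
  have hne : (admissibleBases M).Nonempty := by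
    obtain ⟨B, hB⟩ := hS.nonempty
    rw [hS.bases_eq] at hB
    exact ⟨B, hB⟩
  obtain rfl : S = admissibleBases M := hS.bases_eq
  have hr : M.natRk Set.univ ≤ n := by
    obtain ⟨B, hB, hBa⟩ := hne
    rw [← hB.ncard_eq_natRk hM.ground_eq]
    exact hBa.ncard_le
  have hsub : ∀ ω ∈ flatVectors M, ∀ ν ∈ normalCone (matroidPolytope (admissibleBases M)) ω,
      ν ∈ flatVectors M := fun ω hω ν hν =>
    hM.flatVectors_of_maximizers_subset hr hω ((mem_normalCone_iff hne).1 hν)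
  have hself : ∀ ω, ω ∈ normalCone (matroidPolytope (admissibleBases M)) ω := fun ω =>
    (mem_normalCone_iff hne).2 Set.Subset.rfl
  -- The fan `Σ` is the image of `flatVectors M` under the normal cone map.
  have hX : normalCone (matroidPolytope (admissibleBases M)) '' flatVectors M ⊆
      normalFan (matroidPolytope (admissibleBases M)) := Set.image_subset_range _ _
  have hfan : IsFan (normalCone (matroidPolytope (admissibleBases M)) '' flatVectors M) := by
    refine ⟨(finite_normalFan hne).subset hX, ?_, ?_, ?_⟩
    · rintro _ ⟨ω, -, rfl⟩
      exact hM.normalCone_fg hr hne ω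
    · rintro _ ⟨ω, hω, rfl⟩ τ hτ
      obtain ⟨ν, hν, rfl⟩ := exists_eq_normalCone_of_isFaceOf hne hτ
      exact ⟨ν, hsub ω hω ν (hτ.le hν), rfl⟩
    · rintro _ ⟨ω, -, rfl⟩ _ ⟨ν, -, rfl⟩
      refine ⟨inf_normalCone_isFaceOf hne ω ν, ?_⟩
      rw [inf_comm]
      exact inf_normalCone_isFaceOf hne ν ω
  refine ⟨_, ⟨hX, hfan⟩, bergmanFan_isFan M, hfan, ?_, fun σ hσ => ?_⟩
  · rw [fanSupport_bergmanFan hM]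
    ext ν
    simp only [fanSupport, Set.mem_iUnion, SetLike.mem_coe, exists_prop, Set.exists_mem_image]
    exact ⟨fun hν => ⟨ν, hν, hself ν⟩, fun ⟨ω, hω, hν⟩ => hsub ω hω ν hν⟩
  · obtain ⟨ω, hω, hle⟩ := hM.exists_le_normalCone hr hne hσ
    have hω' : ω ∈ flatVectors M := by
      rw [← fanSupport_bergmanFan hM]
      exact Set.mem_biUnion hσ hω
    exact ⟨_, ⟨ω, hω', rfl⟩, hle⟩
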